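/- Let $G = K_6\setminus K_4$ be the graph with vertices $A_0,A_1,B_1,B_2,B_3,B_4$ and the nine edges $A_0A_1$, $A_0B_i$, $A_1B_i$ ($1\le i\le 4$), and let $G'$ be the $4$-uniform hypergraph with $V(G')=V(G)\sqcup\{X,Y\}$ and $E(G')=\{e\sqcup\{X,Y\} : e\in E(G)\}$. Let $K_n^{(4)}$ be the complete $4$-uniform hypergraph on $n$ vertices. In the strong Ramsey game $\mathcal{R}(K_n^{(4)},G')$ two players, P1 and P2, alternately claim previously unclaimed hyperedges of $K_n^{(4)}$, with P1 moving first; the first player whose claimed hyperedges contain an isomorphic copy of $G'$ wins and the game ends, and if all hyperedges are claimed without this happening, the game is a draw. Then P1 has no strategy which guarantees him a win in less than $2n-O(1)$ total moves as $n\to\infty$. That is, there is a constant $C$ such that for every $n$, P1 has no strategy in $\mathcal{R}(K_n^{(4)},G')$ under which, whatever P2 does, P1 wins with the total number of moves made by both players being less than $2n-C$. -/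

import Mathlib

namespace StrongRamsey

/-! ### The boards and the target hypergraph -/

/-- The complete `r`-uniform hypergraph `K_n^{(r)}` on the vertex set `Fin n`. -/
def completeUniform (n r : ℕ) : Hypergraph (Fin n) where
  vertexSet := Set.univ
  edgeSet := {e | e.ncard = r}
  subset_vertexSet_of_mem_edgeSet' := fun _ _ => Set.subset_univ _

/-- The graph `G = K_6 \ K_4`: the vertices `0, 1` are the ends `A₀, A₁` of the base, the vertices
`2, 3, 4, 5` span the removed `K_4`. -/
def G : SimpleGraph (Fin 6) where
  Adj u v := u ≠ v ∧ (u < 2 ∨ v < 2)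
  symm := ⟨fun _ _ h => ⟨h.1.symm, h.2.symm⟩⟩
  loopless := ⟨fun _ h => h.1 rfl⟩

/-- The 4-uniform hypergraph `G'`: two new vertices (the elements of the summand `Fin 2`) are added
to the vertices of `G` and to every edge of `G`. -/
def G' : Hypergraph (Fin 6 ⊕ Fin 2) where
  vertexSet := Set.univ
  edgeSet := {f | ∃ e ∈ G.edgeSet, f = Sum.inl '' (e : Set (Fin 6)) ∪ Set.range Sum.inr}
  subset_vertexSet_of_mem_edgeSet' := fun _ _ => Set.subset_univ _

/-! ### The strong Ramsey game `R(B, H)`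

A state of the game is the list `h` of all edges claimed so far by both players, the oldest one
first. The entries with even index (`0, 2, 4, …`) were claimed by the first player P1, the entries
with odd index by the second player P2; the length of `h` is the total number of moves. -/

variable {V W : Type*}

/-- The set of edges that P1 has claimed in `h`. -/
def claimedByP1 (h : List (Set V)) : Set (Set V) :=
  {e | ∃ k : ℕ, Even k ∧ h[k]? = some e}

/-- The set of edges that P2 has claimed in `h`. -/
def claimedByP2 (h : List (Set V)) : Set (Set V) :=
  {e | ∃ k : ℕ, Odd k ∧ h[k]? = some e}

/-- The set `S` of edges of the board `B` contains (the edges of) an isomorphic copy of `H`. -/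
def ContainsCopy (B : Hypergraph V) (H : Hypergraph W) (S : Set (Set V)) : Prop :=
  ∃ φ : W → V, Set.InjOn φ H.vertexSet ∧ Set.MapsTo φ H.vertexSet B.vertexSet ∧
    ∀ e ∈ H.edgeSet, φ '' e ∈ S

/-- One of the players has completed a copy of the target. -/
def Decided (B : Hypergraph V) (H : Hypergraph W) (h : List (Set V)) : Prop :=
  ContainsCopy B H (claimedByP1 h) ∨ ContainsCopy B H (claimedByP2 h)

/-- `IsPlay B H h`: the list `h` arises by legal moves from the empty board. A move claims an
edge of the board that nobody has claimed before, and no move is made once a player has completed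
a copy of the target. -/
inductive IsPlay (B : Hypergraph V) (H : Hypergraph W) : List (Set V) → Prop
  | start : IsPlay B H []
  | move {h : List (Set V)} {e : Set V} (hplay : IsPlay B H h) (hopen : ¬ Decided B H h)
      (hboard : e ∈ B.edgeSet) (hnew : e ∉ h) : IsPlay B H (h ++ [e])

/-- The game is over: a player has completed a copy of the target, or no edge is left. -/
def Finished (B : Hypergraph V) (H : Hypergraph W) (h : List (Set V)) : Prop :=
  Decided B H h ∨ ∀ e ∈ B.edgeSet, e ∈ h

/-- A strategy of P1 in `R(B, H)`: it prescribes a legal move whenever it is P1's turn. -/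
structure StrategyP1 (B : Hypergraph V) (H : Hypergraph W) where
  /-- the edge to claim next, as a function of the moves made so far -/
  next : List (Set V) → Set V
  legal : ∀ h, IsPlay B H h → Even h.length → ¬ Finished B H h →
    next h ∈ B.edgeSet ∧ next h ∉ h

/-- All moves of P1 in `h` are those that `σ` prescribes (the moves of P2 are arbitrary). -/
def StrategyP1.Follows {B : Hypergraph V} {H : Hypergraph W} (σ : StrategyP1 B H)
    (h : List (Set V)) : Prop :=
  ∀ (k : ℕ) (hk : k < h.length), Even k → h[k] = σ.next (h.take k)

/-- `σ` guarantees P1 a win in less than `N` total moves: whatever P2 does, the play always has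
less than `N` moves (of both players together), and when it is over P1 has completed a copy of the
target. By the rules of `IsPlay`, P1 then is the first player to do so. -/
def StrategyP1.GuaranteesWinInLessThan {B : Hypergraph V} {H : Hypergraph W}
    (σ : StrategyP1 B H) (N : ℕ) : Prop :=
  ∀ h, IsPlay B H h → σ.Follows h →
    h.length < N ∧ (Finished B H h → ContainsCopy B H (claimedByP1 h))

end StrongRamsey

/-! A copy of `G'` is a book: two triples `S` and `T` sharing the pair that corresponds to `X, Y`,
the spine `S ∪ T`, and four pages, the page of `b` having the halves `insert b S` and `insert b T`.
It has nine edges, and a book with three pages has seven.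

Suppose P2 owns a book with three pages. Claiming `insert b S` at a vertex `b` in no claimed edge
threatens `insert b T`, so P1 has to answer there. The answers all contain `T` and a vertex that is
otherwise new to P1, and they help him only if he had three pages through `T` when the threats began
(`not_hasBook_insert_of_fresh`). So P2 can go on threatening until the vertices run out. A round
costs one vertex, which gives n - O(1) rounds and 2n - O(1) moves (`holds_of_threats`).

P1 may have threats of his own when P2 gets his third page. If P1's edges are `Harmless`, his first
threat fixes a spine, and every later threat opens a new page at that spine (`IsChain`). P2 blocks
with the other half of the page, again at the cost of at most one vertex per round. As soon as P1
makes a move without a threat, P2 starts his own sequence, on a side of his book through which P1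
does not have three pages (`eleven_le_card`, `IsChain.eq_of_hasThreePages`).

It remains to reach three pages while P1 is `Harmless`. P2 first claims a star `{p, q, r, x}` with
four leaves `x`, away from P1's first edge `e₀`. The star is symmetric in `p, q, r`, so P2 decides
only afterwards which of them is the centre `r`, by pigeonhole over P1's edges. If P1 has an edge
meeting `e₀` in at most one vertex, no book uses both, which gives P2 time for a fifth leaf.
Otherwise P1's edges cluster around `e₀`, and the blocks which he must then play at the star fit
into a book with few of them (`card_bookEdges_inter_le_six`). -/

namespace StrongRamsey

/-! ### Books: intersections, stars of triples, and recognising a book from most of its edges -/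

section Books

variable {U : Type*} [DecidableEq U]

/-- The edges of the book with spine `S ∪ T` and page vertices `B`: the spine, and the two halves
`insert b S` and `insert b T` of the page of each `b ∈ B`. -/
def bookEdges (S T B : Finset U) : Finset (Finset U) :=
  insert (S ∪ T) (B.image (insert · S) ∪ B.image (insert · T))

/-- `S` and `T` are triples with two common elements, and the page vertices lie outside them. -/
structure IsBook (S T B : Finset U) : Prop where
  card_left : S.card = 3
  card_right : T.card = 3
  card_union : (S ∪ T).card = 4
  notMem : ∀ b ∈ B, b ∉ S ∪ T

/-- The edge set `E` contains a book with four pages. -/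
def HasBook (E : Finset (Finset U)) : Prop :=
  ∃ S T B : Finset U, IsBook S T B ∧ B.card = 4 ∧ bookEdges S T B ⊆ E

variable {S T B E : Finset U}

lemma mem_bookEdges {e : Finset U} :
    e ∈ bookEdges S T B ↔ e = S ∪ T ∨ (∃ b ∈ B, insert b S = e) ∨ ∃ b ∈ B, insert b T = e := by
  simp [bookEdges]

lemma bookEdges_comm (S T B : Finset U) : bookEdges S T B = bookEdges T S B := by
  ext e
  rw [mem_bookEdges, mem_bookEdges, Finset.union_comm S T,
    or_comm (a := ∃ b ∈ B, insert b S = e)]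

lemma spine_mem_bookEdges : S ∪ T ∈ bookEdges S T B := by simp [mem_bookEdges]

lemma left_mem_bookEdges {b : U} (hb : b ∈ B) : insert b S ∈ bookEdges S T B :=
  mem_bookEdges.2 (Or.inr (Or.inl ⟨b, hb, rfl⟩))

lemma right_mem_bookEdges {b : U} (hb : b ∈ B) : insert b T ∈ bookEdges S T B :=
  mem_bookEdges.2 (Or.inr (Or.inr ⟨b, hb, rfl⟩))

namespace IsBook

lemma symm (h : IsBook S T B) : IsBook T S B :=
  ⟨h.card_right, h.card_left, by rw [Finset.union_comm]; exact h.card_union,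
    fun b hb => by rw [Finset.union_comm]; exact h.notMem b hb⟩

lemma mono {B' : Finset U} (h : IsBook S T B) (hB : B' ⊆ B) : IsBook S T B' :=
  ⟨h.card_left, h.card_right, h.card_union, fun b hb => h.notMem b (hB hb)⟩

lemma ne (h : IsBook S T B) : S ≠ T := by
  rintro rfl
  have := h.card_union
  rw [Finset.union_self, h.card_left] at this
  omega

lemma card_inter (h : IsBook S T B) : (S ∩ T).card = 2 := by
  have := Finset.card_union_add_card_inter S T
  rw [h.card_left, h.card_right, h.card_union] at this
  omega

lemma notMem_left (h : IsBook S T B) {b : U} (hb : b ∈ B) : b ∉ S := fun hS =>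
  h.notMem b hb (Finset.mem_union_left _ hS)

lemma notMem_right (h : IsBook S T B) {b : U} (hb : b ∈ B) : b ∉ T := fun hT =>
  h.notMem b hb (Finset.mem_union_right _ hT)

lemma not_subset_insert (h : IsBook S T B) {b : U} (hb : b ∉ S ∪ T) : ¬ S ⊆ insert b T := by
  intro hs
  have hbS : b ∉ S := fun hS => hb (Finset.mem_union_left _ hS)
  rw [Finset.subset_insert_iff_of_notMem hbS] at hs
  exact h.ne (Finset.eq_of_subset_of_card_le hs (by rw [h.card_left, h.card_right]))

lemma left_or_right_subset {e : Finset U} (he : e ∈ bookEdges S T B) : S ⊆ e ∨ T ⊆ e := by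
  rcases mem_bookEdges.1 he with rfl | ⟨b, -, rfl⟩ | ⟨b, -, rfl⟩
  · exact Or.inl Finset.subset_union_left
  · exact Or.inl (Finset.subset_insert _ _)
  · exact Or.inr (Finset.subset_insert _ _)

lemma card_of_mem (h : IsBook S T B) {e : Finset U} (he : e ∈ bookEdges S T B) : e.card = 4 := by
  rcases mem_bookEdges.1 he with rfl | ⟨b, hb, rfl⟩ | ⟨b, hb, rfl⟩
  · exact h.card_union
  · rw [Finset.card_insert_of_notMem (h.notMem_left hb), h.card_left]
  · rw [Finset.card_insert_of_notMem (h.notMem_right hb), h.card_right]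

/-- Every edge contains `S` or `T`, and these share two elements. This is why edges meeting in at
most one vertex obstruct each other. -/
lemma two_le_card_inter (h : IsBook S T B) {e e' : Finset U} (he : e ∈ bookEdges S T B)
    (he' : e' ∈ bookEdges S T B) : 2 ≤ (e ∩ e').card := by
  have key : ∀ A A' : Finset U, 2 ≤ (A ∩ A').card → A ⊆ e → A' ⊆ e' → 2 ≤ (e ∩ e').card :=
    fun A A' hc hA hA' => hc.trans (Finset.card_le_card (Finset.inter_subset_inter hA hA'))
  have h1 := h.card_inter
  have h2 := h.symm.card_inter
  have h3 := h.card_left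
  have h4 := h.card_right
  rcases left_or_right_subset he with hS | hS <;> rcases left_or_right_subset he' with hT | hT
  · exact key S S (by simp [h3]) hS hT
  · exact key S T h1.ge hS hT
  · exact key T S h2.ge hS hT
  · exact key T T (by simp [h4]) hS hT

lemma card_image_insert (h : IsBook S T B) : (B.image (insert · S)).card = B.card := by
  refine Finset.card_image_of_injOn fun b hb b' hb' hbb => ?_
  have : b ∈ insert b' S := by
    have : insert b S = insert b' S := hbb
    rw [← this]; exact Finset.mem_insert_self _ _
  exact (Finset.mem_insert.1 this).resolve_right (h.notMem_left hb)

lemma card_bookEdges (h : IsBook S T B) : (bookEdges S T B).card = 2 * B.card + 1 := by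
  rw [bookEdges, Finset.card_insert_of_notMem, Finset.card_union_of_disjoint,
    h.card_image_insert, h.symm.card_image_insert]
  · ring
  · rw [Finset.disjoint_left]
    intro e he he'
    obtain ⟨b, hb, rfl⟩ := Finset.mem_image.1 he
    obtain ⟨b', hb', hbb⟩ := Finset.mem_image.1 he'
    refine h.not_subset_insert (h.notMem b' hb') ?_
    have : insert b' T = insert b S := hbb
    rw [this]
    exact Finset.subset_insert _ _
  · intro hmem
    rcases Finset.mem_union.1 hmem with hm | hm <;> obtain ⟨b, hb, hbb⟩ := Finset.mem_image.1 hm <;>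
      refine h.notMem b hb ?_ <;> rw [← hbb] <;> exact Finset.mem_insert_self _ _

/-- A triple other than `S` and `T` lies in at most two edges of the book. -/
lemma card_filter_subset_le_two (h : IsBook S T B) {Q : Finset U} (hQ : Q.card = 3) (hS : Q ≠ S)
    (hT : Q ≠ T) : ((bookEdges S T B).filter (Q ⊆ ·)).card ≤ 2 := by
  by_cases hQK : Q ⊆ S ∪ T
  · refine (Finset.card_le_card (t := {S ∪ T}) fun e he => ?_).trans (by simp)
    obtain ⟨he, hQe⟩ := Finset.mem_filter.1 he
    have aux : ∀ R : Finset U, R.card = 3 → Q ≠ R → ∀ b ∈ B, ¬ Q ⊆ insert b R := by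
      intro R hR hQR b hb hs
      have hbQ : b ∉ Q := fun hbQ => h.notMem b hb (hQK hbQ)
      rw [Finset.subset_insert_iff_of_notMem hbQ] at hs
      exact hQR (Finset.eq_of_subset_of_card_le hs (by rw [hR, hQ]))
    rcases mem_bookEdges.1 he with rfl | ⟨b, hb, rfl⟩ | ⟨b, hb, rfl⟩
    · simp
    · exact absurd hQe (aux S h.card_left hS b hb)
    · exact absurd hQe (aux T h.card_right hT b hb)
  · obtain ⟨b, hbQ, hbK⟩ := Finset.not_subset.1 hQK
    refine (Finset.card_le_card (t := {insert b S, insert b T}) fun e he => ?_).trans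
      Finset.card_le_two
    obtain ⟨he, hQe⟩ := Finset.mem_filter.1 he
    have hbe := hQe hbQ
    rw [Finset.mem_union, not_or] at hbK
    rcases mem_bookEdges.1 he with rfl | ⟨b', hb', rfl⟩ | ⟨b', hb', rfl⟩
    · exact absurd hbe (by simp [hbK])
    · rw [(Finset.mem_insert.1 hbe).resolve_right hbK.1]; simp
    · rw [(Finset.mem_insert.1 hbe).resolve_right hbK.2]; simp

lemma filter_left_subset (h : IsBook S T B) :
    (bookEdges S T B).filter (S ⊆ ·) ⊆ insert (S ∪ T) (B.image (insert · S)) := by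
  intro e he
  obtain ⟨he, hSe⟩ := Finset.mem_filter.1 he
  rcases mem_bookEdges.1 he with rfl | ⟨b, hb, rfl⟩ | ⟨b, hb, rfl⟩
  · simp
  · exact Finset.mem_insert_of_mem (Finset.mem_image_of_mem _ hb)
  · exact absurd hSe (h.not_subset_insert (h.notMem b hb))

lemma card_filter_left_le (h : IsBook S T B) :
    ((bookEdges S T B).filter (S ⊆ ·)).card ≤ B.card + 1 :=
  (Finset.card_le_card h.filter_left_subset).trans
    ((Finset.card_insert_le _ _).trans (by rw [h.card_image_insert]))

/-- If all of `E` but one edge `d` lies in the stars of `S` and `T`, and `d` is far from `S` or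
from `T`, then a book with first triple `S` and enough edges in `E` has second triple `T`. -/
lemma right_eq_of_card_le {T' : Finset U} {E : Finset (Finset U)} {d : Finset U}
    (h : IsBook S T' B) (hT : T.card = 3)
    (hE : ∀ e ∈ E, S ⊆ e ∨ T ⊆ e ∨ e = d) (hd : (d ∩ S).card ≤ 1 ∨ (d ∩ T).card ≤ 1)
    (hc : B.card + 3 ≤ (bookEdges S T' B ∩ E).card) : T' = T := by
  by_contra hne
  have h1 := h.card_filter_left_le
  have h2 : (bookEdges S T' B ∩ E).card ≤ ((bookEdges S T' B).filter (S ⊆ ·)).card +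
      ((bookEdges S T' B ∩ E).filter (¬ S ⊆ ·)).card := by
    rw [← Finset.card_filter_add_card_filter_not (s := bookEdges S T' B ∩ E) (S ⊆ ·)]
    gcongr
    exact Finset.inter_subset_left
  -- The star of `S` accounts for at most `B.card + 1` edges, so two edges of the book in `E` avoid
  -- it; both are halves at `T'`.
  obtain ⟨x, hx, y, hy, hxy⟩ := Finset.one_lt_card.1
    (show 1 < ((bookEdges S T' B ∩ E).filter (¬ S ⊆ ·)).card by omega)
  have shape : ∀ x ∈ (bookEdges S T' B ∩ E).filter (¬ S ⊆ ·),
      ∃ b ∈ B, insert b T' = x ∧ (T ⊆ x ∨ x = d) := by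
    intro x hx
    simp only [Finset.mem_filter, Finset.mem_inter] at hx
    obtain ⟨⟨hx, hxE⟩, hSx⟩ := hx
    have hor := (hE x hxE).resolve_left hSx
    rcases mem_bookEdges.1 hx with rfl | ⟨b, hb, rfl⟩ | ⟨b, hb, rfl⟩
    · exact absurd Finset.subset_union_left hSx
    · exact absurd (Finset.subset_insert _ _) hSx
    · exact ⟨b, hb, rfl, hor⟩
  have inT : ∀ b ∈ B, T ⊆ insert b T' → b ∈ T := by
    intro b hb hs
    by_contra hbT
    rw [Finset.subset_insert_iff_of_notMem hbT] at hs
    exact hne (Finset.eq_of_subset_of_card_le hs (by rw [hT, h.card_right])).symm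
  -- If one of the two edges is `d` and the other contains `T`, then `d` contains `T'`, hence `S ∩
  -- T'` and two elements of `T`, and is far from neither triple.
  have main : ∀ b ∈ B, ∀ b' ∈ B, insert b T' = d → T ⊆ insert b' T' → False := by
    intro b hb b' hb' hbd hs
    have hS2 : 2 ≤ (d ∩ S).card := by
      rw [← h.card_inter, Finset.inter_comm S]
      exact Finset.card_le_card (Finset.inter_subset_inter_right
        (hbd ▸ Finset.subset_insert _ _))
    have hT2 : 2 ≤ (d ∩ T).card := by
      have : (T.erase b').card = 2 := by rw [Finset.card_erase_of_mem (inT b' hb' hs), hT]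
      rw [← this]
      refine Finset.card_le_card (Finset.subset_inter ?_ (Finset.erase_subset _ _))
      rw [← hbd]
      exact (Finset.subset_insert_iff.1 hs).trans (Finset.subset_insert _ _)
    omega
  obtain ⟨b, hb, hbx, hx'⟩ := shape x hx
  obtain ⟨b', hb', hby, hy'⟩ := shape y hy
  rcases hx' with hx' | hx' <;> rcases hy' with hy' | hy'
  · refine hxy ?_
    rw [← hbx] at hx'
    rw [← hby] at hy'
    have := (Finset.mem_insert.1 (hx' (inT b' hb' hy'))).resolve_right (h.notMem_right hb')
    rw [← hbx, ← hby, this]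
  · exact main b' hb' b hb (hby.trans hy') (hbx ▸ hx')
  · exact main b hb b' hb' (hbx.trans hx') (hby ▸ hy')
  · exact hxy (hx'.trans hy'.symm)

/-- A book with enough edges in two stars plus one far edge uses the centres of these stars. -/
lemma eq_or_eq_of_card_le {S' T' : Finset U} {E : Finset (Finset U)} {d : Finset U}
    (h : IsBook S' T' B) (hS : S.card = 3) (hT : T.card = 3) (hB : 3 ≤ B.card)
    (hE : ∀ e ∈ E, S ⊆ e ∨ T ⊆ e ∨ e = d) (hd : (d ∩ S).card ≤ 1 ∨ (d ∩ T).card ≤ 1)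
    (hc : B.card + 3 ≤ (bookEdges S' T' B ∩ E).card) :
    (S' = S ∧ T' = T) ∨ (S' = T ∧ T' = S) := by
  have hE' : ∀ e ∈ E, T ⊆ e ∨ S ⊆ e ∨ e = d := fun e he => by have := hE e he; tauto
  have hc' : B.card + 3 ≤ (bookEdges T' S' B ∩ E).card := by rwa [bookEdges_comm]
  by_cases h1 : S = S'
  · subst h1; exact Or.inl ⟨rfl, h.right_eq_of_card_le hT hE hd hc⟩
  by_cases h2 : T = T'
  · subst h2; exact Or.inl ⟨h.symm.right_eq_of_card_le hS hE' hd.symm hc', rfl⟩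
  by_cases h3 : S = T'
  · subst h3; exact Or.inr ⟨h.symm.right_eq_of_card_le hT hE hd hc', rfl⟩
  by_cases h4 : T = S'
  · subst h4; exact Or.inr ⟨rfl, h.right_eq_of_card_le hS hE' hd.symm hc⟩
  -- Otherwise the stars of `S` and `T` contribute at most two edges each and `d` one, which is
  -- five; but `B.card + 3` is at least six.
  exfalso
  have a1 := h.card_filter_subset_le_two hS h1 h3
  have a2 := h.card_filter_subset_le_two hT h4 h2
  have a3 : bookEdges S' T' B ∩ E ⊆ insert d ((bookEdges S' T' B).filter (S ⊆ ·) ∪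
      (bookEdges S' T' B).filter (T ⊆ ·)) := by
    intro e he
    obtain ⟨he, heE⟩ := Finset.mem_inter.1 he
    rcases hE e heE with h | h | h <;> simp [he, h]
  have a4 := (Finset.card_le_card a3).trans ((Finset.card_insert_le _ _).trans
    (Nat.add_le_add_right (Finset.card_union_le _ _) 1))
  omega

end IsBook

lemma HasBook.nine_le_card {E : Finset (Finset U)} (h : HasBook E) : 9 ≤ E.card := by
  obtain ⟨S, T, B, hb, hB, hs⟩ := h
  have := Finset.card_le_card hs
  rw [hb.card_bookEdges, hB] at this
  omega

lemma HasBook.mono {E E' : Finset (Finset U)} (h : HasBook E) (hE : E ⊆ E') : HasBook E' := by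
  obtain ⟨S, T, B, hb, hB, hs⟩ := h
  exact ⟨S, T, B, hb, hB, hs.trans hE⟩

/-- `E` contains a book with three pages one of whose triples is `S`. -/
def HasThreePages (E : Finset (Finset U)) (S : Finset U) : Prop :=
  ∃ T B : Finset U, IsBook S T B ∧ B.card = 3 ∧ bookEdges S T B ⊆ E

lemma union_eq_of_subset {P Q e : Finset U} (hP : P ⊆ e) (hQ : Q ⊆ e) (he : e.card = 4)
    (hP3 : P.card = 3) (hQ3 : Q.card = 3) (hne : P ≠ Q) : P ∪ Q = e := by
  refine Finset.eq_of_subset_of_card_le (Finset.union_subset hP hQ) ?_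
  rw [he]
  by_contra hlt
  have h1 : P = P ∪ Q := Finset.eq_of_subset_of_card_le Finset.subset_union_left (by omega)
  have h2 : Q = P ∪ Q := Finset.eq_of_subset_of_card_le Finset.subset_union_right (by omega)
  exact hne (h1.trans h2.symm)

/-- If `S ∪ T` is not in `E`, then books with three pages through `S` and through `T` have at most
three edges of `E` in common, so that `E` has at least eleven edges. -/
lemma eleven_le_card {E : Finset (Finset U)} (h : IsBook S T B) (hE : S ∪ T ∉ E)
    (hS : HasThreePages E S) (hT : HasThreePages E T) : 11 ≤ E.card := by
  obtain ⟨P, C, hP, hC, hPE⟩ := hS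
  obtain ⟨Q, D, hQ, hD, hQE⟩ := hT
  have c1 := hP.card_bookEdges
  have c2 := hQ.card_bookEdges
  have noST : ∀ e ∈ bookEdges S P C, S ⊆ e → T ⊆ e → False := fun e he h1 h2 =>
    hE (union_eq_of_subset h1 h2 (hP.card_of_mem he) h.card_left h.card_right h.ne ▸ hPE he)
  have hPT : P ≠ T := by
    rintro rfl
    exact hE (hPE spine_mem_bookEdges)
  have hSQ : S ≠ Q := by
    rintro rfl
    exact hE (by rw [Finset.union_comm]; exact hQE spine_mem_bookEdges)
  -- The bound follows from 7 + 7 - 3 = 11. The second triples `P` and `Q` may coincide, and then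
  -- the common edges are halves at `P`.
  have hinter : (bookEdges S P C ∩ bookEdges T Q D).card ≤ 3 := by
    by_cases hPQ : P = Q
    · subst hPQ
      have hsub : bookEdges S P C ∩ bookEdges T P D ⊆ C.image (insert · P) := by
        intro e he
        obtain ⟨he1, he2⟩ := Finset.mem_inter.1 he
        have hPe : P ⊆ e := by
          rcases IsBook.left_or_right_subset he1 with h1 | h1
          · rcases IsBook.left_or_right_subset he2 with h2 | h2
            · exact (noST e he1 h1 h2).elim
            · exact h2
          · exact h1
        have hmem := hP.symm.filter_left_subset
          (Finset.mem_filter.2 ⟨by rwa [bookEdges_comm], hPe⟩)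
        refine (Finset.mem_insert.1 hmem).resolve_left ?_
        rintro rfl
        have hmem2 := hQ.symm.filter_left_subset
          (Finset.mem_filter.2 ⟨by rwa [bookEdges_comm], hPe⟩)
        rcases Finset.mem_insert.1 hmem2 with h3 | h3
        · exact noST _ he1 Finset.subset_union_right (h3 ▸ Finset.subset_union_right)
        · obtain ⟨b, hb, hbe⟩ := Finset.mem_image.1 h3
          have hbe : insert b P = P ∪ S := hbe
          have hbS : b ∈ S := by
            have : b ∈ P ∪ S := hbe ▸ Finset.mem_insert_self _ _
            exact (Finset.mem_union.1 this).resolve_left (hQ.notMem_right hb)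
          have hbT := hQ.notMem_left hb
          refine hE ?_
          have : S ∪ T = insert b T := by
            symm
            refine Finset.eq_of_subset_of_card_le (Finset.insert_subset
              (Finset.mem_union_left _ hbS) Finset.subset_union_right) ?_
            rw [h.card_union, Finset.card_insert_of_notMem hbT, h.card_right]
          rw [this]
          exact hQE (left_mem_bookEdges hb)
      refine (Finset.card_le_card hsub).trans (Finset.card_image_le.trans hC.le)
    -- A common edge contains a triple of each book. These are distinct, so their union is the edge;
    -- the union `S ∪ T` is excluded.
    · refine (Finset.card_le_card (t := {S ∪ Q, P ∪ T, P ∪ Q}) fun e he => ?_).trans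
        Finset.card_le_three
      obtain ⟨he1, he2⟩ := Finset.mem_inter.1 he
      have h4 := hP.card_of_mem he1
      have hu : ∀ X Y : Finset U, X ⊆ e → Y ⊆ e → X.card = 3 → Y.card = 3 → X ≠ Y → X ∪ Y = e :=
        fun X Y hX hY hX3 hY3 hne => union_eq_of_subset hX hY h4 hX3 hY3 hne
      rcases IsBook.left_or_right_subset he1 with h1 | h1 <;>
        rcases IsBook.left_or_right_subset he2 with h2 | h2
      · exact (noST e he1 h1 h2).elim
      · simp [hu S Q h1 h2 hP.card_left hQ.card_right hSQ]
      · simp [hu P T h1 h2 hP.card_right hQ.card_left hPT]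
      · simp [hu P Q h1 h2 hP.card_right hQ.card_right hPQ]
  have hu := Finset.card_union_add_card_inter (bookEdges S P C) (bookEdges T Q D)
  have hle := Finset.card_le_card (Finset.union_subset hPE hQE)
  omega

end Books

/-! ### Holding out for `k` rounds, and the sequence of threats at new vertices -/

section Survival

variable {U : Type*} [DecidableEq U] {S T B : Finset U} {E : Finset (Finset U)}

/-- With P1 to move, having claimed `E₁` against `E₂`, P2 can play so that P1 does not complete a
book in his next `k` moves (or P2 completes one before). -/
def Holds : ℕ → Finset (Finset U) → Finset (Finset U) → Prop
  | 0, _, _ => True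
  | k + 1, E₁, E₂ => ∀ e : Finset U, e.card = 4 → e ∉ E₁ → e ∉ E₂ → ¬ HasBook (insert e E₁) ∧
      ∃ f : Finset U, f.card = 4 ∧ f ∉ insert e E₁ ∧ f ∉ E₂ ∧
        (HasBook (insert f E₂) ∨ Holds k (insert e E₁) (insert f E₂))

/-- With P2 to move, he has a move after which `Holds k`, or which completes a book. -/
def Reply (k : ℕ) (E₁ E₂ : Finset (Finset U)) : Prop :=
  ∃ f : Finset U, f.card = 4 ∧ f ∉ E₁ ∧ f ∉ E₂ ∧
    (HasBook (insert f E₂) ∨ Holds k E₁ (insert f E₂))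

lemma holds_zero (E₁ E₂ : Finset (Finset U)) : Holds 0 E₁ E₂ := by
  unfold Holds; trivial

lemma holds_succ {k : ℕ} {E₁ E₂ : Finset (Finset U)} : Holds (k + 1) E₁ E₂ ↔
    ∀ e : Finset U, e.card = 4 → e ∉ E₁ → e ∉ E₂ →
      ¬ HasBook (insert e E₁) ∧ Reply k (insert e E₁) E₂ := Iff.rfl

/-- The vertices of the claimed edges. -/
def verts (E₁ E₂ : Finset (Finset U)) : Finset U := (E₁ ∪ E₂).biUnion id

lemma subset_verts_left {E₁ E₂ : Finset (Finset U)} {e : Finset U} (he : e ∈ E₁) :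
    e ⊆ verts E₁ E₂ :=
  Finset.subset_biUnion_of_mem id (Finset.mem_union_left _ he)

lemma subset_verts_right {E₁ E₂ : Finset (Finset U)} {e : Finset U} (he : e ∈ E₂) :
    e ⊆ verts E₁ E₂ :=
  Finset.subset_biUnion_of_mem id (Finset.mem_union_right _ he)

lemma verts_insert_left {E₁ E₂ : Finset (Finset U)} {e : Finset U} :
    verts (insert e E₁) E₂ = e ∪ verts E₁ E₂ := by
  simp [verts, Finset.insert_union, Finset.biUnion_insert]

lemma verts_insert_right {E₁ E₂ : Finset (Finset U)} {e : Finset U} :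
    verts E₁ (insert e E₂) = e ∪ verts E₁ E₂ := by
  simp [verts, Finset.union_insert, Finset.biUnion_insert]

/-- In `E₁`, extended by edges `insert r T` with new vertices `r`, one edge `f` completes a book
only if it completes one in `E₀` or if `E₀` has a book with three pages through `T`. -/
lemma not_hasBook_insert_of_fresh {E₀ E₁ : Finset (Finset U)} {R f : Finset U}
    (hthree : ¬ HasThreePages E₀ T) (hE₁ : E₁ ⊆ E₀ ∪ R.image (insert · T))
    (hR : ∀ r ∈ R, r ∉ T ∧ ∀ e ∈ E₀, r ∉ e) (hf : ¬ HasBook (insert f E₀)) :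
    ¬ HasBook (insert f E₁) := by
  rintro ⟨P, Q, C, hb, hC, hsub⟩
  have hcases : ∀ e ∈ bookEdges P Q C, e = f ∨ e ∈ E₀ ∨ ∃ r ∈ R, insert r T = e := by
    intro e he
    rcases Finset.mem_insert.1 (hsub he) with h | h
    · exact Or.inl h
    · rcases Finset.mem_union.1 (hE₁ h) with h | h
      · exact Or.inr (Or.inl h)
      · exact Or.inr (Or.inr (by simpa using h))
  have hdeg : ∀ r ∈ R, ∀ e ∈ bookEdges P Q C, r ∈ e → e = f ∨ e = insert r T := by
    intro r hr e he hre
    rcases hcases e he with h | h | ⟨r', hr', rfl⟩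
    · exact Or.inl h
    · exact absurd hre ((hR r hr).2 e h)
    · rw [(Finset.mem_insert.1 hre).resolve_right (hR r hr).1]
      exact Or.inr rfl
  -- Each triple of the book lies in four halves, but a new vertex lies in at most two book edges;
  -- so new vertices can only be page vertices.
  have hnot : ∀ P Q : Finset U, IsBook P Q C →
      (∀ r ∈ R, ∀ e ∈ bookEdges P Q C, r ∈ e → e = f ∨ e = insert r T) →
      ∀ r ∈ R, r ∉ P := by
    intro P Q hb hdeg r hr hrP
    have h5 : (C.image (insert · P)).card = 4 := by rw [hb.card_image_insert, hC]
    have : C.image (insert · P) ⊆ {f, insert r T} := by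
      intro e he
      obtain ⟨c, hc, rfl⟩ := Finset.mem_image.1 he
      have := hdeg r hr _ (left_mem_bookEdges hc) (Finset.mem_insert_of_mem hrP)
      simpa using this
    have := (Finset.card_le_card this).trans Finset.card_le_two
    omega
  -- A half `insert r T` with `r` new makes `T` one of the triples, and the other half at `r` can
  -- only be `f`. Without this page the book has three pages through `T`. They lie in `E₀`, since a
  -- second new page vertex would need `f` as its other half too.
  have hclaim : ∀ P Q : Finset U, IsBook P Q C → bookEdges P Q C ⊆ insert f E₁ →
      (∀ r ∈ R, ∀ e ∈ bookEdges P Q C, r ∈ e → e = f ∨ e = insert r T) →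
      ∀ r ∈ R, ∀ c ∈ C, insert c P = insert r T → insert r T ≠ f → False := by
    intro P Q hb hsub hdeg r hr c hc hcr hne
    have hnP := hnot P Q hb hdeg
    have hnQ := hnot Q P hb.symm (by rwa [bookEdges_comm])
    have key : ∀ r' ∈ R, ∀ c' ∈ C, r' ∈ insert c' P ∨ r' ∈ insert c' Q → c' = r' := by
      intro r' hr' c' hc' h
      rcases h with h | h
      · exact ((Finset.mem_insert.1 h).resolve_right (hnP r' hr')).symm
      · exact ((Finset.mem_insert.1 h).resolve_right (hnQ r' hr')).symm
    have hcr' : c = r := key r hr c hc (Or.inl (hcr ▸ Finset.mem_insert_self _ _))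
    subst hcr'
    have hPT : P = T := by
      have := congrArg (Finset.erase · c) hcr
      simpa [Finset.erase_insert (hb.notMem_left hc), Finset.erase_insert (hR c hr).1] using this
    subst hPT
    have hfQ : insert c Q = f := by
      refine (hdeg c hr _ (right_mem_bookEdges hc) (Finset.mem_insert_self _ _)).resolve_right ?_
      intro h
      exact hb.not_subset_insert (hb.notMem c hc) (h ▸ Finset.subset_insert _ _)
    refine hthree ⟨Q, C.erase c, hb.mono (Finset.erase_subset _ _),
      by rw [Finset.card_erase_of_mem hc, hC], fun e he => ?_⟩
    have hsub' : e ∈ bookEdges P Q C := by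
      rcases mem_bookEdges.1 he with h | ⟨b, hb, h⟩ | ⟨b, hb, h⟩
      · exact h ▸ spine_mem_bookEdges
      · exact h ▸ left_mem_bookEdges (Finset.mem_of_mem_erase hb)
      · exact h ▸ right_mem_bookEdges (Finset.mem_of_mem_erase hb)
    have hce : c ∉ e := by
      rcases mem_bookEdges.1 he with h | ⟨b, hb', h⟩ | ⟨b, hb', h⟩
      · exact h ▸ hb.notMem c hc
      · intro hce
        exact (Finset.mem_erase.1 hb').1 (key c hr b (Finset.mem_of_mem_erase hb')
          (Or.inl (h ▸ hce)))
      · intro hce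
        exact (Finset.mem_erase.1 hb').1 (key c hr b (Finset.mem_of_mem_erase hb')
          (Or.inr (h ▸ hce)))
    have hef : e ≠ f := fun h => hce (by rw [h, ← hfQ]; exact Finset.mem_insert_self _ _)
    have heE₁ := hE₁ ((Finset.mem_insert.1 (hsub hsub')).resolve_left hef)
    rcases Finset.mem_union.1 heE₁ with h | h
    · exact h
    exfalso
    obtain ⟨r', hr', rfl⟩ := Finset.mem_image.1 h
    have hr'C : r' ∈ C := by
      rcases mem_bookEdges.1 hsub' with h | ⟨b, hb', h⟩ | ⟨b, hb', h⟩
      · have : r' ∈ P ∪ Q := h ▸ Finset.mem_insert_self _ _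
        exact absurd this (by simp [hnP r' hr', hnQ r' hr'])
      · rw [← key r' hr' b hb' (Or.inl (h ▸ Finset.mem_insert_self _ _))]; exact hb'
      · rw [← key r' hr' b hb' (Or.inr (h ▸ Finset.mem_insert_self _ _))]; exact hb'
    have hne' : r' ≠ c := fun h => hce (h ▸ Finset.mem_insert_self _ _)
    have h1 : insert r' Q = f := by
      refine (hdeg r' hr' _ (right_mem_bookEdges hr'C)
        (Finset.mem_insert_self _ _)).resolve_right ?_
      intro h
      exact hb.not_subset_insert (hb.notMem r' hr'C) (h ▸ Finset.subset_insert _ _)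
    have : r' ∈ insert c Q := by rw [hfQ, ← h1]; exact Finset.mem_insert_self _ _
    exact hne' ((Finset.mem_insert.1 this).resolve_right (hnQ r' hr'))
  by_cases hall : bookEdges P Q C ⊆ insert f E₀
  · exact hf ⟨P, Q, C, hb, hC, hall⟩
  obtain ⟨x, hx, hxn⟩ := Finset.not_subset.1 hall
  rw [Finset.mem_insert, not_or] at hxn
  obtain ⟨r, hr, rfl⟩ := ((hcases x hx).resolve_left hxn.1).resolve_left hxn.2
  have hcomm := bookEdges_comm P Q C
  rcases mem_bookEdges.1 hx with h | ⟨c, hc, h⟩ | ⟨c, hc, h⟩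
  · have : r ∈ P ∪ Q := h ▸ Finset.mem_insert_self _ _
    rcases Finset.mem_union.1 this with h | h
    · exact hnot P Q hb hdeg r hr h
    · exact hnot Q P hb.symm (hcomm ▸ hdeg) r hr h
  · exact hclaim P Q hb hsub hdeg r hr c hc h hxn.1
  · exact hclaim Q P hb.symm (hcomm ▸ hsub) (hcomm ▸ hdeg) r hr c hc h hxn.1

lemma hasBook_insert (h : IsBook S T B) (hB : B.card = 3) {b : U} (hbB : b ∉ B)
    (hb : b ∉ S ∪ T) (hsub : bookEdges S T B ⊆ E) (hS : insert b S ∈ E) :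
    HasBook (insert (insert b T) E) := by
  refine ⟨S, T, insert b B, ⟨h.card_left, h.card_right, h.card_union, ?_⟩,
    by rw [Finset.card_insert_of_notMem hbB, hB], fun e he => ?_⟩
  · intro c hc
    rcases Finset.mem_insert.1 hc with rfl | hc
    · exact hb
    · exact h.notMem c hc
  · rcases mem_bookEdges.1 he with rfl | ⟨c, hc, rfl⟩ | ⟨c, hc, rfl⟩
    · exact Finset.mem_insert_of_mem (hsub spine_mem_bookEdges)
    · rcases Finset.mem_insert.1 hc with rfl | hc
      · exact Finset.mem_insert_of_mem hS
      · exact Finset.mem_insert_of_mem (hsub (left_mem_bookEdges hc))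
    · rcases Finset.mem_insert.1 hc with rfl | hc
      · exact Finset.mem_insert_self _ _
      · exact Finset.mem_insert_of_mem (hsub (right_mem_bookEdges hc))

lemma exists_notMem_of_card_lt [Fintype U] {s : Finset U} (h : s.card < Fintype.card U) :
    ∃ b, b ∉ s := by
  by_contra hall
  push Not at hall
  rw [Finset.eq_univ_iff_forall.2 hall, Finset.card_univ] at h
  omega

variable [Fintype U]

/-- P2 keeps P1 busy with threats at new vertices. -/
theorem holds_of_threats {E₀ : Finset (Finset U)} (h : IsBook S T B) (hB : B.card = 3)
    (hthree : ¬ HasThreePages E₀ T) (k : ℕ) :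
    ∀ {E₁ E₂ : Finset (Finset U)} {R : Finset U} {b : U}, bookEdges S T B ⊆ E₂ →
    insert b S ∈ E₂ → b ∉ S ∪ T → b ∉ B → insert b T ∉ E₁ → insert b T ∉ E₂ →
    E₀ ⊆ E₁ → E₁ ⊆ E₀ ∪ R.image (insert · T) → (∀ r ∈ R, r ∉ T ∧ ∀ e ∈ E₀, r ∉ e) → (∀ e ∈ E₀, b ∉ e) →
    (∀ f, f ∉ E₁ → f ∉ E₂ → ¬ HasBook (insert f E₀)) →
    (verts E₁ E₂).card + k ≤ Fintype.card U → Holds k E₁ E₂ := by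
  induction k with
  | zero => intros; exact holds_zero _ _
  | succ k ih =>
    intro E₁ E₂ R b hsub hbS hb hbB hbT₁ hbT₂ hE₀ hE₁ hR hbE₀ hno hcard
    rw [holds_succ]
    intro e he he₁ he₂
    refine ⟨not_hasBook_insert_of_fresh hthree hE₁ hR (hno e he₁ he₂), ?_⟩
    have hbT : b ∉ T := fun hT => hb (Finset.mem_union_right _ hT)
    by_cases heb : e = insert b T
    -- P1 has answered the threat. P2 renews it at an unused vertex `c`, and `b` joins the set `R`
    -- of answered vertices.
    · obtain ⟨c, hc⟩ := exists_notMem_of_card_lt (show (verts E₁ E₂).card < Fintype.card U by omega)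
      have hSTv : S ∪ T ⊆ verts E₁ E₂ := subset_verts_right (hsub spine_mem_bookEdges)
      have hcST : c ∉ S ∪ T := fun h => hc (hSTv h)
      have hcS : c ∉ S := fun h => hcST (Finset.mem_union_left _ h)
      have hbv : b ∈ verts E₁ E₂ := subset_verts_right hbS (Finset.mem_insert_self _ _)
      have hcb : c ≠ b := by rintro rfl; exact hc hbv
      have hev : e ⊆ verts E₁ E₂ := by
        rw [heb]
        exact Finset.insert_subset hbv (Finset.subset_union_right.trans hSTv)
      have hnew₁ : ∀ X : Finset U, insert c X ∉ E₁ := fun X hX =>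
        hc (subset_verts_left hX (Finset.mem_insert_self _ _))
      have hnew₂ : ∀ X : Finset U, insert c X ∉ E₂ := fun X hX =>
        hc (subset_verts_right hX (Finset.mem_insert_self _ _))
      have hnewe : ∀ X : Finset U, insert c X ≠ e := by
        rintro X rfl
        exact hc (hev (Finset.mem_insert_self _ _))
      have hv : verts (insert e E₁) (insert (insert c S) E₂) = insert c (verts E₁ E₂) := by
        rw [verts_insert_left, verts_insert_right, Finset.insert_union,
          Finset.union_eq_right.2 (Finset.subset_union_left.trans hSTv), Finset.union_eq_right.2]
        exact hev.trans (Finset.subset_insert _ _)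
      refine ⟨insert c S, by rw [Finset.card_insert_of_notMem hcS, h.card_left],
        by simp [hnew₁, hnewe], hnew₂ S, Or.inr ?_⟩
      refine ih (R := insert b R) (b := c) (hsub.trans (Finset.subset_insert _ _))
        (Finset.mem_insert_self _ _) hcST ?_ ?_ ?_ (hE₀.trans (Finset.subset_insert _ _)) ?_ ?_ ?_ ?_ ?_
      · intro hcB
        exact hc (subset_verts_right (hsub (left_mem_bookEdges hcB)) (Finset.mem_insert_self _ _))
      · simp [hnew₁, hnewe]
      · rw [Finset.mem_insert, not_or]
        refine ⟨fun hcc => ?_, hnew₂ T⟩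
        exact h.not_subset_insert hcST (hcc ▸ Finset.subset_insert _ _)
      · intro x hx
        rcases Finset.mem_insert.1 hx with rfl | hx
        · rw [heb]
          exact Finset.mem_union_right _ (Finset.mem_image_of_mem _ (Finset.mem_insert_self _ _))
        · refine Finset.union_subset_union_right (Finset.image_subset_image ?_) (hE₁ hx)
          exact Finset.subset_insert _ _
      · intro r hr
        rcases Finset.mem_insert.1 hr with rfl | hr
        · exact ⟨hbT, hbE₀⟩
        · exact hR r hr
      · intro x hx hcx
        exact hc (subset_verts_left (hE₀ hx) hcx)
      · intro f hf₁ hf₂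
        rw [Finset.mem_insert, not_or] at hf₁ hf₂
        exact hno f hf₁.2 hf₂.2
      · rw [hv, Finset.card_insert_of_notMem hc]
        omega
    -- P1 has ignored the threat, and P2 completes his fourth page.
    · refine ⟨insert b T, by rw [Finset.card_insert_of_notMem hbT, h.card_right], ?_, hbT₂,
        Or.inl (hasBook_insert h hB hbB hb hsub hbS)⟩
      rw [Finset.mem_insert, not_or]
      exact ⟨fun h => heb h.symm, hbT₁⟩

end Survival

/-! ### From a three-page book of P2 to his threats, past the threats of P1 -/

section Handover

variable {U : Type*} [DecidableEq U] {S T B : Finset U} {E₁ E₂ : Finset (Finset U)}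

/-- All threats of P1 consist in opening a new page at the spine `S ∪ T`: his edges, with the
exception of `d`, contain `S` or `T`, and the other half of a page which he has opened is claimed. -/
structure IsChain (E₁ E₂ : Finset (Finset U)) (S T d : Finset U) : Prop where
  book : IsBook S T ∅
  spine : S ∪ T ∈ E₁ ∨ S ∪ T ∈ E₂
  stars : ∀ e ∈ E₁, S ⊆ e ∨ T ⊆ e ∨ e = d
  far : (d ∩ S).card ≤ 1 ∨ (d ∩ T).card ≤ 1
  left : ∀ b, b ∉ S ∪ T → insert b S ∈ E₁ → insert b T ∈ E₁ ∨ insert b T ∈ E₂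
  right : ∀ b, b ∉ S ∪ T → insert b T ∈ E₁ → insert b S ∈ E₁ ∨ insert b S ∈ E₂
  noBook : ¬ HasBook E₁
  disj : Disjoint E₁ E₂

/-- `e` and `f` are the two halves of one page. -/
def IsPage (S T e f : Finset U) : Prop :=
  ∃ b, b ∉ S ∪ T ∧ ((e = insert b S ∧ f = insert b T) ∨ (e = insert b T ∧ f = insert b S))

lemma IsBook.insert_ne (h : IsBook S T B) {b c : U} (hc : c ∉ S ∪ T) :
    insert b S ≠ insert c T := fun h' =>
  h.not_subset_insert hc (h' ▸ Finset.subset_insert _ _)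

/-- Of the nine edges at most two are new. Seven is the `B.card + 3` that
`IsBook.eq_or_eq_of_card_le` needs for four pages. -/
lemma card_inter_bookEdges {e f : Finset U} {E : Finset (Finset U)}
    (hb : IsBook S T B) (hB : B.card = 4) (hsub : bookEdges S T B ⊆ insert f (insert e E)) :
    7 ≤ (bookEdges S T B ∩ E).card := by
  have h1 := hb.card_bookEdges
  have h2 : bookEdges S T B ⊆ insert f (insert e (bookEdges S T B ∩ E)) := by
    intro x hx
    have := hsub hx
    simp only [Finset.mem_insert, Finset.mem_inter] at this ⊢
    tauto
  have h3 := Finset.card_le_card h2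
  have h4 := Finset.card_insert_le f (insert e (bookEdges S T B ∩ E))
  have h5 := Finset.card_insert_le e (bookEdges S T B ∩ E)
  omega

namespace IsChain

variable {d e f : Finset U}

/-- Seven edges of the book are in `E₁`, so its triples are `S` and `T`. Its missing edges cannot be
single halves, because P2 owns the counterpart of every half that P1 owns alone. Hence a whole page
is missing, and `e` and `f` are its halves. -/
lemma isPage (h : IsChain E₁ E₂ S T d) (he : e ∉ E₂) (hf : f ∉ E₂)
    (hb : HasBook (insert f (insert e E₁))) : e ≠ f ∧ IsPage S T e f := by
  obtain ⟨P, Q, C, hPQ, hC, hsub⟩ := hb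
  have h7 := card_inter_bookEdges hPQ hC hsub
  obtain ⟨hb, hsub⟩ : IsBook S T C ∧ bookEdges S T C ⊆ insert f (insert e E₁) := by
    rcases hPQ.eq_or_eq_of_card_le h.book.card_left h.book.card_right (by omega) h.stars h.far
      (by omega) with ⟨rfl, rfl⟩ | ⟨rfl, rfl⟩
    · exact ⟨hPQ, hsub⟩
    · exact ⟨hPQ.symm, by rwa [bookEdges_comm]⟩
  have hno₂ : ∀ x ∈ bookEdges S T C, x ∉ E₂ := by
    intro x hx hx₂
    rcases Finset.mem_insert.1 (hsub hx) with rfl | hx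
    · exact hf hx₂
    rcases Finset.mem_insert.1 hx with rfl | hx
    · exact he hx₂
    · exact Finset.disjoint_left.1 h.disj hx hx₂
  have hspine : S ∪ T ∈ E₁ := h.spine.resolve_right (hno₂ _ spine_mem_bookEdges)
  obtain ⟨x, hx, hx₁⟩ : ∃ x ∈ bookEdges S T C, x ∉ E₁ := by
    by_contra hall
    push Not at hall
    exact h.noBook ⟨S, T, C, hb, hC, hall⟩
  -- If one half of the page of `x` were in `E₁`, then `x`, being outside `E₁`, would be in `E₂`;
  -- but the book avoids `E₂`.
  obtain ⟨b, hbC, hbS, hbT⟩ : ∃ b ∈ C, insert b S ∉ E₁ ∧ insert b T ∉ E₁ := by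
    rcases mem_bookEdges.1 hx with rfl | ⟨b, hbC, rfl⟩ | ⟨b, hbC, rfl⟩
    · exact absurd hspine hx₁
    · refine ⟨b, hbC, hx₁, fun hbT => ?_⟩
      rcases h.right b (hb.notMem b hbC) hbT with h' | h'
      · exact hx₁ h'
      · exact hno₂ _ hx h'
    · refine ⟨b, hbC, fun hbS => ?_, hx₁⟩
      rcases h.left b (hb.notMem b hbC) hbS with h' | h'
      · exact hx₁ h'
      · exact hno₂ _ hx h'
  have hne := hb.insert_ne (b := b) (hb.notMem b hbC)
  have h1 := hsub (left_mem_bookEdges hbC)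
  have h2 := hsub (right_mem_bookEdges hbC)
  simp only [Finset.mem_insert, hbS, hbT, or_false] at h1 h2
  have hbK := hb.notMem b hbC
  rcases h1 with h1 | h1 <;> rcases h2 with h2 | h2
  · exact absurd (h1.trans h2.symm) hne
  · exact ⟨fun h => hne (h1.trans (h.symm.trans h2.symm)), b, hbK, Or.inr ⟨h2.symm, h1.symm⟩⟩
  · exact ⟨fun h => hne (h1.trans (h.trans h2.symm)), b, hbK, Or.inl ⟨h1.symm, h2.symm⟩⟩
  · exact absurd (h1.trans h2.symm) hne

/-- One edge cannot fill a missing page: this is `isPage` with `f = e`, which would give `e ≠ e`. -/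
lemma not_hasBook_insert (h : IsChain E₁ E₂ S T d) (he : e ∉ E₂) : ¬ HasBook (insert e E₁) :=
  fun hb => (h.isPage he he (hb.mono (Finset.subset_insert _ _))).1 rfl

lemma symm (h : IsChain E₁ E₂ S T d) : IsChain E₁ E₂ T S d where
  book := h.book.symm
  spine := by rw [Finset.union_comm]; exact h.spine
  stars e he := by have := h.stars e he; tauto
  far := h.far.symm
  left := by rw [Finset.union_comm]; exact h.right
  right := by rw [Finset.union_comm]; exact h.left
  noBook := h.noBook
  disj := h.disj

/-- The invariant survives a round in which P1 opens a page and P2 takes its other half. -/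
lemma insert_page (h : IsChain E₁ E₂ S T d) {b : U} (hb : b ∉ S ∪ T) (he : insert b S ∉ E₂)
    (hf : insert b T ∉ E₁) : IsChain (insert (insert b S) E₁) (insert (insert b T) E₂) S T d where
  book := h.book
  spine := h.spine.imp (Finset.mem_insert_of_mem ·) (Finset.mem_insert_of_mem ·)
  stars e he := by
    rcases Finset.mem_insert.1 he with rfl | he
    · exact Or.inl (Finset.subset_insert _ _)
    · exact h.stars e he
  far := h.far
  left c hc hcS := by
    rcases Finset.mem_insert.1 hcS with h' | h'
    · have : c ∈ insert b S := h' ▸ Finset.mem_insert_self _ _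
      have hcb := (Finset.mem_insert.1 this).resolve_right fun h => hc (Finset.mem_union_left _ h)
      subst hcb
      exact Or.inr (Finset.mem_insert_self _ _)
    · exact (h.left c hc h').imp (Finset.mem_insert_of_mem ·) (Finset.mem_insert_of_mem ·)
  right c hc hcT := by
    rcases Finset.mem_insert.1 hcT with h' | h'
    · exact absurd h'.symm (h.book.insert_ne hc)
    · exact (h.right c hc h').imp (Finset.mem_insert_of_mem ·) (Finset.mem_insert_of_mem ·)
  noBook := h.not_hasBook_insert he
  disj := by
    rw [Finset.disjoint_insert_left, Finset.disjoint_insert_right, Finset.mem_insert, not_or]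
    exact ⟨⟨h.book.insert_ne hb, he⟩, hf, h.disj⟩

lemma insert_of_isPage (h : IsChain E₁ E₂ S T d) (hp : IsPage S T e f) (he : e ∉ E₂)
    (hf : f ∉ E₁) : IsChain (insert e E₁) (insert f E₂) S T d := by
  obtain ⟨b, hb, ⟨rfl, rfl⟩ | ⟨rfl, rfl⟩⟩ := hp
  · exact h.insert_page hb he hf
  · exact (h.symm.insert_page (by rwa [Finset.union_comm]) he hf).symm

/-- A three-page book has seven edges, six of them in `E₁`. This is again `B.card + 3`, so its
triples are `S` and `T`. -/
lemma eq_of_hasThreePages (h : IsChain E₁ E₂ S T d) {P : Finset U}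
    (hP : HasThreePages (insert e E₁) P) : (P = S ∨ P = T) ∧ S ∪ T ∈ insert e E₁ := by
  obtain ⟨Q, C, hb, hC, hsub⟩ := hP
  have h1 := hb.card_bookEdges
  have h2 : bookEdges P Q C ⊆ insert e (bookEdges P Q C ∩ E₁) := by
    intro x hx
    have := hsub hx
    simp only [Finset.mem_insert, Finset.mem_inter] at this ⊢
    tauto
  have h3 := (Finset.card_le_card h2).trans (Finset.card_insert_le _ _)
  have hs : P ∪ Q ∈ insert e E₁ := hsub spine_mem_bookEdges
  rcases hb.eq_or_eq_of_card_le h.book.card_left h.book.card_right (by omega) h.stars h.far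
      (by omega) with ⟨rfl, rfl⟩ | ⟨rfl, rfl⟩
  · exact ⟨Or.inl rfl, hs⟩
  · exact ⟨Or.inr rfl, by rwa [Finset.union_comm]⟩

lemma subset_verts (h : IsChain E₁ E₂ S T d) : S ∪ T ⊆ verts E₁ E₂ :=
  h.spine.elim subset_verts_left subset_verts_right

end IsChain

lemma card_of_hasBook_insert {f : Finset U} {E : Finset (Finset U)} (hE : ¬ HasBook E)
    (hf : HasBook (insert f E)) : f.card = 4 := by
  obtain ⟨S, T, B, hb, hB, hsub⟩ := hf
  by_cases hfb : f ∈ bookEdges S T B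
  · exact hb.card_of_mem hfb
  · exact absurd ⟨S, T, B, hb, hB, (Finset.subset_insert_iff_of_notMem hfb).1 hsub⟩ hE

lemma card_verts_insert_insert_le {e f : Finset U} (he : e.card = 4) (hf : f.card = 4) :
    (verts (insert e E₁) (insert f E₂)).card ≤ (verts E₁ E₂).card + 8 := by
  rw [verts_insert_left, verts_insert_right]
  have h1 := Finset.card_union_le e (f ∪ verts E₁ E₂)
  have h2 := Finset.card_union_le f (verts E₁ E₂)
  omega

lemma card_verts_insert_le {e : Finset U} (he : e.card = 4) :
    (verts (insert e E₁) E₂).card ≤ (verts E₁ E₂).card + 4 := by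
  rw [verts_insert_left]
  have h1 := Finset.card_union_le e (verts E₁ E₂)
  omega

/-- P1, to move, is not close to a second threat. -/
def Harmless (E : Finset (Finset U)) : Prop :=
  E.card ≤ 7 ∨ (E.card ≤ 8 ∧ ∃ u ∈ E, ∃ v ∈ E, (u ∩ v).card ≤ 1) ∨
    (E.card ≤ 9 ∧ ∀ S T B : Finset U, IsBook S T B → B.card = 4 →
      (bookEdges S T B ∩ E).card ≤ 6)

/-- Completing a book with one edge requires eight of its edges. A far pair cannot lie in one book,
which rules out eight edges in the second case. -/
lemma Harmless.not_hasBook_insert {E : Finset (Finset U)} (h : Harmless E) (e : Finset U) :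
    ¬ HasBook (insert e E) := by
  rintro ⟨S, T, B, hb, hB, hsub⟩
  have h1 := hb.card_bookEdges
  have h2 : bookEdges S T B ⊆ insert e (bookEdges S T B ∩ E) := by
    intro x hx
    have := hsub hx
    simp only [Finset.mem_insert, Finset.mem_inter] at this ⊢
    tauto
  have h3 := (Finset.card_le_card h2).trans (Finset.card_insert_le _ _)
  have h4 : (bookEdges S T B ∩ E).card ≤ E.card := Finset.card_le_card Finset.inter_subset_right
  rcases h with h | ⟨h, u, hu, v, hv, huv⟩ | ⟨h, hbook⟩
  · omega
  · have heq : bookEdges S T B ∩ E = E :=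
      Finset.eq_of_subset_of_card_le Finset.inter_subset_right (by omega)
    rw [← heq, Finset.mem_inter] at hu hv
    have := hb.two_le_card_inter hu.1 hv.1
    omega
  · have := hbook S T B hb hB
    omega

/-- A threat needs seven book edges in `E₁`. This excludes the third case of `Harmless`, and in the
others at most one edge `d` of `E₁` is outside the book; such a `d` belongs to the far pair. All
other edges of P1 are in the book, and all of the book is claimed once P2 blocks with `f`. -/
lemma Harmless.isChain {e f : Finset U} (h : Harmless E₁) (hdisj : Disjoint E₁ E₂)
    (he₂ : e ∉ E₂) (hf₁ : f ∉ insert e E₁) (hf : HasBook (insert f (insert e E₁))) :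
    ∃ S T d, IsChain (insert e E₁) (insert f E₂) S T d := by
  obtain ⟨S, T, B, hb, hB, hsub⟩ := hf
  have h7 := card_inter_bookEdges hb hB hsub
  have heb : e ∈ bookEdges S T B := by
    by_contra hn
    refine h.not_hasBook_insert f ⟨S, T, B, hb, hB, ?_⟩
    rw [Finset.insert_comm] at hsub
    exact (Finset.subset_insert_iff_of_notMem hn).1 hsub
  obtain ⟨d, hd, u, hu, hud⟩ : ∃ d, E₁ ⊆ insert d (bookEdges S T B) ∧
      ∃ u ∈ bookEdges S T B, (d ∩ u).card ≤ 1 := by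
    rcases h with h | ⟨h, u, hu, v, hv, huv⟩ | ⟨-, hbook⟩
    -- All of `E₁` is in the book, so there is no exceptional edge and `∅` serves as `d`.
    · refine ⟨∅, ?_, S ∪ T, spine_mem_bookEdges, by simp⟩
      have heq : bookEdges S T B ∩ E₁ = E₁ :=
        Finset.eq_of_subset_of_card_le Finset.inter_subset_right (by omega)
      rw [← heq]
      exact Finset.inter_subset_left.trans (Finset.subset_insert _ _)
    · have hsd : (E₁ \ bookEdges S T B).card ≤ 1 := by
        have := Finset.card_sdiff_add_card_inter E₁ (bookEdges S T B)
        rw [Finset.inter_comm] at this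
        omega
      have key : ∀ u ∈ E₁, ∀ v ∈ E₁, u ∉ bookEdges S T B → E₁ ⊆ insert u (bookEdges S T B) ∧
          (v ∈ bookEdges S T B ∨ v = u) := by
        intro u hu v hv hun
        have hsub' : E₁ ⊆ insert u (bookEdges S T B) := by
          intro x hx
          by_cases hxb : x ∈ bookEdges S T B
          · exact Finset.mem_insert_of_mem hxb
          · rw [Finset.card_le_one.1 hsd x (Finset.mem_sdiff.2 ⟨hx, hxb⟩) u
              (Finset.mem_sdiff.2 ⟨hu, hun⟩)]
            exact Finset.mem_insert_self _ _
        exact ⟨hsub', (Finset.mem_insert.1 (hsub' hv)).symm⟩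
      by_cases hub : u ∈ bookEdges S T B
      · by_cases hvb : v ∈ bookEdges S T B
        · have := hb.two_le_card_inter hub hvb
          omega
        · exact ⟨v, (key v hv u hu hvb).1, u, hub, by rwa [Finset.inter_comm]⟩
      · rcases (key u hu v hv hub).2 with hvb | rfl
        · exact ⟨u, (key u hu v hv hub).1, v, hvb, huv⟩
        -- The far pair may degenerate to `u = v`, a set with at most one element.
        · rw [Finset.inter_self] at huv
          refine ⟨v, (key v hu v hv hub).1, S ∪ T, spine_mem_bookEdges, ?_⟩
          exact (Finset.card_le_card Finset.inter_subset_left).trans huv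
    · have := hbook S T B hb hB
      omega
  have hfar : (d ∩ S).card ≤ 1 ∨ (d ∩ T).card ≤ 1 :=
    (IsBook.left_or_right_subset hu).imp
      (fun h => (Finset.card_le_card (Finset.inter_subset_inter_left h)).trans hud)
      (fun h => (Finset.card_le_card (Finset.inter_subset_inter_left h)).trans hud)
  have hin : ∀ x ∈ insert e E₁, x ∈ bookEdges S T B ∨ x = d := by
    intro x hx
    rcases Finset.mem_insert.1 hx with rfl | hx
    · exact Or.inl heb
    · exact (Finset.mem_insert.1 (hd hx)).symm
  have hspl : ∀ x ∈ bookEdges S T B, x ∈ insert e E₁ ∨ x ∈ insert f E₂ := by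
    intro x hx
    rcases Finset.mem_insert.1 (hsub hx) with rfl | hx
    · exact Or.inr (Finset.mem_insert_self _ _)
    · exact Or.inl hx
  have hhalf : ∀ P Q : Finset U, IsBook P Q B → bookEdges P Q B = bookEdges S T B →
      ((d ∩ P).card ≤ 1 ∨ (d ∩ Q).card ≤ 1) → ∀ b, b ∉ P ∪ Q → insert b P ∈ insert e E₁ →
      insert b Q ∈ insert e E₁ ∨ insert b Q ∈ insert f E₂ := by
    intro P Q hPQ heq hfar b hbn hbP
    rcases hin _ hbP with hmem | hmem
    · rw [← heq] at hmem
      rcases Finset.mem_insert.1 (hPQ.filter_left_subset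
        (Finset.mem_filter.2 ⟨hmem, Finset.subset_insert _ _⟩)) with h' | h'
      · exact absurd (h' ▸ Finset.mem_insert_self _ _) hbn
      · obtain ⟨c, hc, hcb⟩ := Finset.mem_image.1 h'
        have hcb : insert c P = insert b P := hcb
        have : b ∈ insert c P := hcb ▸ Finset.mem_insert_self _ _
        rw [(Finset.mem_insert.1 this).resolve_right fun h => hbn (Finset.mem_union_left _ h)]
        exact hspl _ (heq ▸ right_mem_bookEdges hc)
    -- A half `insert b P` equal to `d` would meet `P` in three and `Q` in at least two elements.
    · exfalso
      have hPd : P ⊆ d := hmem ▸ Finset.subset_insert _ _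
      have h3 := hPQ.card_left
      have h2 := hPQ.card_inter
      rw [Finset.inter_eq_right.2 hPd] at hfar
      have := Finset.card_le_card (Finset.inter_subset_inter_right hPd : P ∩ Q ⊆ d ∩ Q)
      omega
  refine ⟨S, T, d, hb.mono (Finset.empty_subset _), hspl _ spine_mem_bookEdges, ?_, hfar,
    hhalf S T hb rfl hfar, ?_, h.not_hasBook_insert e, ?_⟩
  · intro x hx
    rcases hin x hx with hx | hx
    · rcases IsBook.left_or_right_subset hx with h | h <;> simp [h]
    · simp [hx]
  · have := hhalf T S hb.symm (bookEdges_comm _ _ _) hfar.symm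
    rwa [Finset.union_comm] at this
  · rw [Finset.disjoint_insert_right, Finset.disjoint_insert_left]
    exact ⟨hf₁, he₂, hdisj⟩

variable [Fintype U] {Ta Tb Bs : Finset U} {k : ℕ}

/-- P2 starts his sequence of threats. -/
lemma reply_of_no_threat (h : IsBook Ta Tb Bs) (hB : Bs.card = 3) (hsub : bookEdges Ta Tb Bs ⊆ E₂)
    (hno : ∀ f, f ∉ E₁ → f ∉ E₂ → ¬ HasBook (insert f E₁))
    (hthree : ¬ HasThreePages E₁ Ta ∨ ¬ HasThreePages E₁ Tb)
    (hcard : (verts E₁ E₂).card + (k + 1) ≤ Fintype.card U) : Reply k E₁ E₂ := by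
  wlog hTb : ¬ HasThreePages E₁ Tb generalizing Ta Tb
  · exact this h.symm (by rwa [bookEdges_comm]) hthree.symm (hthree.resolve_right hTb)
  obtain ⟨b, hb⟩ := exists_notMem_of_card_lt (show (verts E₁ E₂).card < Fintype.card U by omega)
  have hv : Ta ∪ Tb ⊆ verts E₁ E₂ := subset_verts_right (hsub spine_mem_bookEdges)
  have hbab : b ∉ Ta ∪ Tb := fun h => hb (hv h)
  have hba : b ∉ Ta := fun h => hbab (Finset.mem_union_left _ h)
  have hnew₁ : ∀ X : Finset U, insert b X ∉ E₁ := fun X hX =>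
    hb (subset_verts_left hX (Finset.mem_insert_self _ _))
  have hnew₂ : ∀ X : Finset U, insert b X ∉ E₂ := fun X hX =>
    hb (subset_verts_right hX (Finset.mem_insert_self _ _))
  refine ⟨insert b Ta, by rw [Finset.card_insert_of_notMem hba, h.card_left], hnew₁ _, hnew₂ _,
    Or.inr ?_⟩
  refine holds_of_threats (E₀ := E₁) (R := ∅) (b := b) h hB hTb k
    (hsub.trans (Finset.subset_insert _ _)) (Finset.mem_insert_self _ _) hbab ?_ (hnew₁ _) ?_
    subset_rfl (by simp) (by simp) ?_ ?_ ?_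
  · intro hbB
    exact hnew₂ _ (hsub (left_mem_bookEdges hbB))
  · rw [Finset.mem_insert, not_or]
    exact ⟨fun h' => h.insert_ne hbab h'.symm, hnew₂ _⟩
  · intro e he hbe
    exact hb (subset_verts_left he hbe)
  · intro f hf₁ hf₂
    exact hno f hf₁ fun h => hf₂ (Finset.mem_insert_of_mem h)
  · rw [verts_insert_right, Finset.insert_union,
      Finset.union_eq_right.2 (Finset.subset_union_left.trans hv), Finset.card_insert_of_notMem hb]
    omega

/-- A threat of P1 and its block add at most one vertex, so the induction loses one vertex per
round. The slack of 4 pays for P1's first move without a threat, after which P2 takes over. -/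
theorem IsChain.holds (h : IsBook Ta Tb Bs) (hB : Bs.card = 3) (k : ℕ) :
    ∀ {E₁ E₂ : Finset (Finset U)} {S T d : Finset U}, IsChain E₁ E₂ S T d →
    bookEdges Ta Tb Bs ⊆ E₂ → (verts E₁ E₂).card + k + 4 ≤ Fintype.card U → Holds k E₁ E₂ := by
  induction k with
  | zero => intros; exact holds_zero _ _
  | succ k ih =>
    intro E₁ E₂ S T d hch hsub hcard
    rw [holds_succ]
    intro e he he₁ he₂
    have hbk := hch.not_hasBook_insert he₂
    refine ⟨hbk, ?_⟩
    by_cases hex : ∃ f, f ∉ insert e E₁ ∧ f ∉ E₂ ∧ HasBook (insert f (insert e E₁))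
    · obtain ⟨f, hf₁, hf₂, hf⟩ := hex
      refine ⟨f, card_of_hasBook_insert hbk hf, hf₁, hf₂, Or.inr ?_⟩
      have hp := (hch.isPage he₂ hf₂ hf).2
      refine ih (hch.insert_of_isPage hp he₂ fun h => hf₁ (Finset.mem_insert_of_mem h))
        (hsub.trans (Finset.subset_insert _ _)) ?_
      have hv := hch.subset_verts
      have : ∃ b, verts (insert e E₁) (insert f E₂) ⊆ insert b (verts E₁ E₂) := by
        obtain ⟨b, -, hb⟩ := hp
        refine ⟨b, ?_⟩
        have hS : insert b S ⊆ insert b (verts E₁ E₂) :=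
          Finset.insert_subset_insert _ (Finset.subset_union_left.trans hv)
        have hT : insert b T ⊆ insert b (verts E₁ E₂) :=
          Finset.insert_subset_insert _ (Finset.subset_union_right.trans hv)
        rw [verts_insert_left, verts_insert_right]
        rcases hb with ⟨rfl, rfl⟩ | ⟨rfl, rfl⟩
        · exact Finset.union_subset hS (Finset.union_subset hT (Finset.subset_insert _ _))
        · exact Finset.union_subset hT (Finset.union_subset hS (Finset.subset_insert _ _))
      obtain ⟨b, hb⟩ := this
      have := (Finset.card_le_card hb).trans (Finset.card_insert_le _ _)
      omega
    · push Not at hex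
      have hv := card_verts_insert_le (E₁ := E₁) (E₂ := E₂) he
      refine reply_of_no_threat h hB hsub hex ?_ (by omega)
      -- Three pages of P1 through both `Ta` and `Tb` would make these his triples `S` and `T`, and
      -- P1 would own the spine of P2's book.
      by_contra hcon
      rw [not_or, not_not, not_not] at hcon
      obtain ⟨ha, hsp⟩ := hch.eq_of_hasThreePages hcon.1
      obtain ⟨hb, -⟩ := hch.eq_of_hasThreePages hcon.2
      have hne := h.ne
      have hK : Ta ∪ Tb ∈ insert e E₁ := by
        rcases ha with rfl | rfl <;> rcases hb with rfl | rfl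
        · exact absurd rfl hne
        · exact hsp
        · rwa [Finset.union_comm]
        · exact absurd rfl hne
      have hK₂ : Ta ∪ Tb ∈ E₂ := hsub spine_mem_bookEdges
      rcases Finset.mem_insert.1 hK with h' | h'
      · exact he₂ (h' ▸ hK₂)
      · exact Finset.disjoint_left.1 hch.disj h' hK₂

/-- If P1's next move is a threat, the block turns the position into a chain; if not, P2 starts
threatening at once. The slack of 12 is eight vertices for that round and the 4 of `IsChain.holds`.
-/
theorem Harmless.holds (h : Harmless E₁) (hdisj : Disjoint E₁ E₂) (hb : IsBook Ta Tb Bs)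
    (hB : Bs.card = 3) (hsub : bookEdges Ta Tb Bs ⊆ E₂)
    (hcard : (verts E₁ E₂).card + k + 12 ≤ Fintype.card U) : Holds k E₁ E₂ := by
  cases k with
  | zero => exact holds_zero _ _
  | succ k =>
    rw [holds_succ]
    intro e he he₁ he₂
    have hbk := h.not_hasBook_insert e
    refine ⟨hbk, ?_⟩
    by_cases hex : ∃ f, f ∉ insert e E₁ ∧ f ∉ E₂ ∧ HasBook (insert f (insert e E₁))
    · obtain ⟨f, hf₁, hf₂, hf⟩ := hex
      have hf4 := card_of_hasBook_insert hbk hf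
      obtain ⟨S, T, d, hch⟩ := h.isChain hdisj he₂ hf₁ hf
      have hv := card_verts_insert_insert_le (E₁ := E₁) (E₂ := E₂) he hf4
      exact ⟨f, hf4, hf₁, hf₂, Or.inr (IsChain.holds hb hB k hch
        (hsub.trans (Finset.subset_insert _ _)) (by omega))⟩
    · push Not at hex
      have hv := card_verts_insert_le (E₁ := E₁) (E₂ := E₂) he
      refine reply_of_no_threat hb hB hsub hex ?_ (by omega)
      by_contra hcon
      rw [not_or, not_not, not_not] at hcon
      have hK₂ : Ta ∪ Tb ∈ E₂ := hsub spine_mem_bookEdges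
      have hK : Ta ∪ Tb ∉ insert e E₁ := by
        rw [Finset.mem_insert, not_or]
        exact ⟨fun h' => he₂ (h' ▸ hK₂), fun h' => Finset.disjoint_left.1 hdisj h' hK₂⟩
      -- P1 has at most ten edges, too few for three pages through both triples.
      have h11 := eleven_le_card hb hK hcon.1 hcon.2
      have h1 := Finset.card_insert_le e E₁
      rcases h with h | ⟨h, -⟩ | ⟨h, -⟩ <;> omega

end Handover

/-! ### The end of the opening: from a star with a far pair to three pages -/

section Opening

variable {U : Type*} [DecidableEq U] {E₁ E₂ : Finset (Finset U)} {m k : ℕ}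
  {p q r a b c d : U}

/-- The edge which corresponds to `ab` on the board of the edges through `p` and `q`. -/
def ed (p q a b : U) : Finset U := {p, q, a, b}

lemma ed_comm (p q a b : U) : ed p q a b = ed p q b a := by
  ext; simp [ed]; tauto

lemma ed_ne (h : a ≠ p ∧ a ≠ q ∧ a ≠ c ∧ a ≠ d) : ed p q a b ≠ ed p q c d := by
  intro h'
  have : a ∈ ed p q c d := by rw [← h']; simp [ed]
  simp [ed, h] at this

lemma ed_ne' (h : b ≠ p ∧ b ≠ q ∧ b ≠ c ∧ b ≠ d) : ed p q a b ≠ ed p q c d := by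
  rw [ed_comm]; exact ed_ne h

lemma card_ed (h : [p, q, a, b].Nodup) : (ed p q a b).card = 4 := by
  simpa [ed] using List.toFinset_card_of_nodup h

/-- The edges of the players are disjoint and have at most `m` vertices. -/
structure Position (E₁ E₂ : Finset (Finset U)) (m : ℕ) : Prop where
  disj : Disjoint E₁ E₂
  card_verts : (verts E₁ E₂).card ≤ m

lemma Position.insert_left (h : Position E₁ E₂ m) {e : Finset U} (he : e.card = 4) (he₂ : e ∉ E₂) :
    Position (insert e E₁) E₂ (m + 4) :=
  ⟨Finset.disjoint_insert_left.2 ⟨he₂, h.disj⟩,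
    (card_verts_insert_le he).trans (Nat.add_le_add_right h.card_verts 4)⟩

lemma Position.insert_right (h : Position E₁ E₂ m) {e : Finset U} (he : e.card = 4)
    (he₁ : e ∉ E₁) : Position E₁ (insert e E₂) (m + 4) := by
  refine ⟨Finset.disjoint_insert_right.2 ⟨he₁, h.disj⟩, ?_⟩
  have := h.card_verts
  rw [verts_insert_right]
  have h1 := Finset.card_union_le e (verts E₁ E₂)
  omega

lemma exists_fresh [Fintype U] (s : Finset U) (h : s.card + 4 ≤ Fintype.card U) :
    ∃ e : Finset U, e.card = 4 ∧ Disjoint e s := by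
  have : 4 ≤ (Finset.univ \ s).card := by
    have := Finset.le_card_sdiff s Finset.univ
    rw [Finset.card_univ] at this
    omega
  obtain ⟨e, he, hc⟩ := Finset.exists_subset_card_eq this
  exact ⟨e, hc, Finset.disjoint_of_subset_left he Finset.sdiff_disjoint⟩

lemma holds_of_reply (h : Position E₁ E₂ m) (hE : Harmless E₁)
    (H : ∀ l, k = l + 1 → ∀ e : Finset U, e.card = 4 → Position (insert e E₁) E₂ (m + 4) →
      Reply l (insert e E₁) E₂) : Holds k E₁ E₂ := by
  cases k with
  | zero => exact holds_zero _ _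
  | succ k =>
    rw [holds_succ]
    exact fun e he he₁ he₂ => ⟨hE.not_hasBook_insert e, H k rfl e he (h.insert_left he he₂)⟩

/-- Two edges which no book contains both. -/
def HasFarPair (E : Finset (Finset U)) : Prop := ∃ u ∈ E, ∃ v ∈ E, (u ∩ v).card ≤ 1

lemma HasFarPair.mono {E E' : Finset (Finset U)} (h : HasFarPair E) (hE : E ⊆ E') :
    HasFarPair E' := by
  obtain ⟨u, hu, v, hv, huv⟩ := h
  exact ⟨u, hE hu, v, hE hv, huv⟩

lemma HasFarPair.harmless {E : Finset (Finset U)} (h : HasFarPair E) (hE : E.card ≤ 8) :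
    Harmless E := Or.inr (Or.inl ⟨hE, h⟩)

variable [Fintype U]

/-- P2 claims `g`, or any new edge if `g` is his already. -/
lemma reply_of_claim (h : Position E₁ E₂ m) (hm : m + 4 ≤ Fintype.card U) {g : Finset U}
    (hg : g.card = 4) (hg₁ : g ∉ E₁)
    (H : ∀ E₂', insert g E₂ ⊆ E₂' → Position E₁ E₂' (m + 4) → Holds k E₁ E₂') :
    Reply k E₁ E₂ := by
  by_cases hg₂ : g ∈ E₂
  · obtain ⟨e, he, hd⟩ := exists_fresh (verts E₁ E₂) (by have := h.card_verts; omega)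
    have hne : e.Nonempty := Finset.card_pos.1 (by omega)
    have hn : ¬ e ⊆ verts E₁ E₂ := fun hs => by
      have := Finset.disjoint_of_subset_right hs hd
      rw [Finset.disjoint_self_iff_empty] at this
      exact hne.ne_empty this
    have he₁ : e ∉ E₁ := fun h => hn (subset_verts_left h)
    refine ⟨e, he, he₁, fun h => hn (subset_verts_right h), Or.inr (H _ ?_ (h.insert_right he he₁))⟩
    rw [Finset.insert_eq_of_mem hg₂]
    exact Finset.subset_insert _ _
  · exact ⟨g, hg, hg₁, hg₂, Or.inr (H _ subset_rfl (h.insert_right hg hg₁))⟩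

/-- P2 completes a book with three pages with spine through `r` and `c`. -/
lemma reply_of_third_page {w₁ w₂ w₃ : U} (nd : [p, q, r, c, w₁, w₂, w₃].Nodup)
    (h : Position E₁ E₂ m) (hm : m + k + 16 ≤ Fintype.card U) (hE : Harmless E₁)
    (hstar : ∀ x ∈ [c, w₁, w₂, w₃], ed p q r x ∈ E₂) (h₁ : ed p q c w₁ ∈ E₂)
    (h₂ : ed p q c w₂ ∈ E₂) (h₃ : ed p q c w₃ ∉ E₁) : Reply k E₁ E₂ := by
  simp at nd
  refine reply_of_claim h (by omega) (card_ed (by simp; tauto)) h₃ fun E₂' hsub hpos => ?_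
  have hins : ∀ x y, insert x ({p, q, y} : Finset U) = ed p q y x := by
    intro x y; ext; simp [ed]; tauto
  have hK : ({p, q, r} ∪ {p, q, c} : Finset U) = ed p q r c := by
    ext; simp [ed]
  have hb : IsBook ({p, q, r} : Finset U) {p, q, c} {w₁, w₂, w₃} := by
    refine ⟨?_, ?_, ?_, ?_⟩
    · rw [Finset.card_eq_three]; exact ⟨p, q, r, by tauto, by tauto, by tauto, rfl⟩
    · rw [Finset.card_eq_three]; exact ⟨p, q, c, by tauto, by tauto, by tauto, rfl⟩
    · rw [hK]; exact card_ed (by simp; tauto)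
    · rw [hK]; simp [ed]; grind
  have hsub₂ : E₂ ⊆ E₂' := (Finset.subset_insert _ _).trans hsub
  simp only [List.mem_cons, List.not_mem_nil, or_false, forall_eq_or_imp, forall_eq] at hstar
  refine hE.holds hpos.disj hb ?_ ?_ (by have := hpos.card_verts; omega)
  · rw [Finset.card_eq_three]; exact ⟨w₁, w₂, w₃, by tauto, by tauto, by tauto, rfl⟩
  · intro e he
    rcases mem_bookEdges.1 he with rfl | ⟨x, hx, rfl⟩ | ⟨x, hx, rfl⟩
    · rw [hK]; exact hsub₂ hstar.1
    · rw [hins]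
      simp only [Finset.mem_insert, Finset.mem_singleton] at hx
      rcases hx with rfl | rfl | rfl
      · exact hsub₂ hstar.2.1
      · exact hsub₂ hstar.2.2.1
      · exact hsub₂ hstar.2.2.2
    · rw [hins]
      simp only [Finset.mem_insert, Finset.mem_singleton] at hx
      rcases hx with rfl | rfl | rfl
      · exact hsub₂ h₁
      · exact hsub₂ h₂
      · exact hsub (Finset.mem_insert_self _ _)

/-- With one page at the spine through `r` and `c` and three leaves which P1 has not separated
from `c`, P2 needs two more moves. -/
lemma reply_of_three_open {w₀ w₁ w₂ w₃ : U} (nd : [p, q, r, c, w₀, w₁, w₂, w₃].Nodup)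
    (h : Position E₁ E₂ m) (hm : m + k + 24 ≤ Fintype.card U) (hE : E₁.card ≤ 7)
    (hfar : HasFarPair E₁) (hstar : ∀ x ∈ [c, w₀, w₁, w₂, w₃], ed p q r x ∈ E₂)
    (h₀ : ed p q c w₀ ∈ E₂) (hopen : ∀ x ∈ [w₁, w₂, w₃], ed p q c x ∉ E₁) : Reply k E₁ E₂ := by
  simp at nd
  simp only [List.mem_cons, List.not_mem_nil, or_false, forall_eq_or_imp, forall_eq] at hstar hopen
  refine reply_of_claim h (by omega) (card_ed (by simp; tauto)) hopen.1 fun E₂' hsub hpos => ?_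
  refine holds_of_reply hpos (Or.inl hE) fun l hl e he hpos => ?_
  have hsub₂ : E₂ ⊆ E₂' := (Finset.subset_insert _ _).trans hsub
  have hharm : Harmless (insert e E₁) := (hfar.mono (Finset.subset_insert _ _)).harmless
    ((Finset.card_insert_le _ _).trans (by omega))
  have h₁ : ed p q c w₁ ∈ E₂' := hsub (Finset.mem_insert_self _ _)
  -- The third page can be completed at `w₂` or at `w₃`, and P1's move blocks at most one of them.
  by_cases he2 : e = ed p q c w₂
  · refine reply_of_third_page (p := p) (q := q) (r := r) (w₁ := w₀) (w₂ := w₁) (w₃ := w₃) (by simp; tauto) hpos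
      (by omega) hharm ?_ (hsub₂ h₀) h₁ ?_
    · simp [hsub₂ hstar.1, hsub₂ hstar.2.1, hsub₂ hstar.2.2.1, hsub₂ hstar.2.2.2.2]
    · rw [Finset.mem_insert, not_or]
      exact ⟨fun h => ed_ne' (by grind) (h.trans he2), hopen.2.2⟩
  · refine reply_of_third_page (p := p) (q := q) (r := r) (w₁ := w₀) (w₂ := w₁) (w₃ := w₂) (by simp; tauto) hpos
      (by omega) hharm ?_ (hsub₂ h₀) h₁ ?_
    · simp [hsub₂ hstar.1, hsub₂ hstar.2.1, hsub₂ hstar.2.2.1, hsub₂ hstar.2.2.2.1]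
    · rw [Finset.mem_insert, not_or]
      exact ⟨fun h => he2 h.symm, hopen.2.1⟩

/-- With a star with five leaves, two of which P1 has not separated from the others, P2 needs
three more moves. -/
lemma reply_of_two_centers {c' w₁ w₂ w₃ : U} (nd : [p, q, r, c, c', w₁, w₂, w₃].Nodup)
    (h : Position E₁ E₂ m) (hm : m + k + 32 ≤ Fintype.card U) (hE : E₁.card ≤ 6)
    (hfar : HasFarPair E₁) (hstar : ∀ x ∈ [c, c', w₁, w₂, w₃], ed p q r x ∈ E₂)
    (h₀ : ed p q c c' ∉ E₁) (hopen : ∀ x ∈ [w₁, w₂, w₃], ed p q c x ∉ E₁)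
    (hopen' : ∀ x ∈ [w₁, w₂, w₃], ed p q c' x ∉ E₁) : Reply k E₁ E₂ := by
  simp at nd
  refine reply_of_claim h (by omega) (card_ed (by simp; tauto)) h₀ fun E₂' hsub hpos => ?_
  refine holds_of_reply hpos (Or.inl (by omega)) fun l hl e he hpos => ?_
  have hsub₂ : E₂ ⊆ E₂' := (Finset.subset_insert _ _).trans hsub
  have hc : (insert e E₁).card ≤ 7 := (Finset.card_insert_le _ _).trans (by omega)
  have h₁ : ed p q c c' ∈ E₂' := hsub (Finset.mem_insert_self _ _)
  -- The edge of `c` and `c'` is a half of a page for either choice of centre. An edge of P1 at `c`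
  -- leaves `c'` untouched.
  by_cases hhit : ∃ x ∈ [w₁, w₂, w₃], ed p q c x = e
  · obtain ⟨x, hx, rfl⟩ := hhit
    refine reply_of_three_open (p := p) (q := q) (r := r) (c := c') (w₀ := c) (w₁ := w₁) (w₂ := w₂) (w₃ := w₃)
      (by simp; grind) hpos (by omega) hc (hfar.mono (Finset.subset_insert _ _)) ?_
      (by rwa [ed_comm]) ?_
    · intro y hy
      refine hsub₂ (hstar y ?_)
      simp at hy ⊢
      tauto
    · intro y hy
      rw [Finset.mem_insert, not_or]
      refine ⟨ed_ne ?_, hopen' y hy⟩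
      simp at hx
      grind
  · push Not at hhit
    refine reply_of_three_open (p := p) (q := q) (r := r) (c := c) (w₀ := c') (w₁ := w₁) (w₂ := w₂) (w₃ := w₃)
      (by simp; grind) hpos (by omega) hc (hfar.mono (Finset.subset_insert _ _)) ?_ h₁ ?_
    · intro y hy
      exact hsub₂ (hstar y hy)
    · intro y hy
      rw [Finset.mem_insert, not_or]
      exact ⟨hhit y hy, hopen y hy⟩

/-- The previous lemma applies if P1 has at most one edge which separates leaves. -/
lemma reply_of_five_leaves {L : Finset U} (nd : [p, q, r].Nodup) (hL : L.card = 5)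
    (hpL : p ∉ L) (hqL : q ∉ L) (hrL : r ∉ L)
    (h : Position E₁ E₂ m) (hm : m + k + 32 ≤ Fintype.card U) (hE : E₁.card ≤ 6)
    (hfar : HasFarPair E₁) (h4 : ∀ e ∈ E₁, e.card = 4) (hstar : ∀ x ∈ L, ed p q r x ∈ E₂)
    (hone : (E₁.filter fun e => p ∈ e ∧ q ∈ e ∧ r ∉ e).card ≤ 1) : Reply k E₁ E₂ := by
  simp at nd
  -- `g` is the only edge of P1 that can separate leaves, or `∅` if there is none. It contains `p`
  -- and `q`, so at most two leaves.
  obtain ⟨g, hg, hgE⟩ : ∃ g : Finset U, (g ∩ L).card ≤ 2 ∧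
      ∀ e ∈ E₁, p ∈ e → q ∈ e → r ∉ e → e = g := by
    by_cases hex : ∃ g ∈ E₁, p ∈ g ∧ q ∈ g ∧ r ∉ g
    · obtain ⟨g, hgE, hpg, hqg, hrg⟩ := hex
      refine ⟨g, ?_, fun e he hpe hqe hre => Finset.card_le_one.1 hone e (by simp; tauto) g
        (by simp; tauto)⟩
      have : g ∩ L ⊆ (g.erase p).erase q := by
        intro x hx
        simp only [Finset.mem_inter] at hx
        simp only [Finset.mem_erase]
        exact ⟨fun h => hqL (h ▸ hx.2), fun h => hpL (h ▸ hx.2), hx.1⟩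
      refine (Finset.card_le_card this).trans ?_
      rw [Finset.card_erase_of_mem (by simp; tauto), Finset.card_erase_of_mem hpg, h4 g hgE]
    · push Not at hex
      exact ⟨∅, by simp, fun e he hp hq hr => absurd (hex e he hp hq) hr⟩
  -- At least three of the five leaves avoid `g`; two of them become the candidate centres.
  have h3 : 1 < (L \ g).card := by
    have := Finset.card_sdiff_add_card_inter L g
    rw [Finset.inter_comm] at this
    omega
  obtain ⟨c, hc, c', hc', hne⟩ := Finset.one_lt_card.1 h3
  rw [Finset.mem_sdiff] at hc hc'
  have hcard : ((L.erase c).erase c').card = 3 := by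
    rw [Finset.card_erase_of_mem (by simp; tauto), Finset.card_erase_of_mem hc.1, hL]
  obtain ⟨w₁, w₂, w₃, h12, h13, h23, hw⟩ := Finset.card_eq_three.1 hcard
  have hmem : ∀ x ∈ [w₁, w₂, w₃], x ≠ c' ∧ x ≠ c ∧ x ∈ L := by
    intro x hx
    have : x ∈ (L.erase c).erase c' := by rw [hw]; simpa using hx
    simpa using this
  have hno : ∀ x ∈ L, ∀ y ∈ L, x ∉ g → ed p q x y ∉ E₁ := by
    intro x hx y hy hxg hxy
    have := hgE _ hxy (by simp [ed]) (by simp [ed]) (by simp [ed]; grind)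
    exact hxg (this ▸ by simp [ed])
  have m1 := hmem w₁ (by simp)
  have m2 := hmem w₂ (by simp)
  have m3 := hmem w₃ (by simp)
  refine reply_of_two_centers (p := p) (q := q) (r := r) (c := c) (c' := c') (w₁ := w₁) (w₂ := w₂) (w₃ := w₃) ?_
    h hm hE hfar ?_ (hno _ hc.1 _ hc'.1 hc.2) (fun x hx => hno _ hc.1 _ (hmem x hx).2.2 hc.2)
    (fun x hx => hno _ hc'.1 _ (hmem x hx).2.2 hc'.2)
  · simp; grind
  · intro x hx
    refine hstar x ?_
    simp at hx
    grind

end Opening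

/-! ### P1's edges clustered around `e₀`, and the line with three blocks -/

section NearEdges

variable {U : Type*} [DecidableEq U] {E₁ E₂ O : Finset (Finset U)} {e₀ : Finset U} {m k : ℕ}
  {p q r : U}

lemma disjoint_ed {x y : U} (h : ∀ z ∈ [p, q, x, y], z ∉ e₀) : Disjoint (ed p q x y) e₀ := by
  rw [Finset.disjoint_left]
  intro z hz
  exact h z (by simpa [ed] using hz)

lemma ed_notMem {x y : U} (hO : ∀ f ∈ O, 2 ≤ (f ∩ e₀).card)
    (h : ∀ z ∈ [p, q, x, y], z ∉ e₀) : ed p q x y ∉ O := by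
  intro hmem
  have := hO _ hmem
  rw [Finset.disjoint_iff_inter_eq_empty.1 (disjoint_ed h)] at this
  simp at this

/-- If the edges of `O` all meet `e₀` in two vertices, then those which are in a book with two
edges of the board of `p` and `q` contain `p` or `q`, but no further vertex of P2. -/
lemma near_of_two_blocks {f : Finset U} {a b c d : U} (hf : f.card = 4)
    (hfe : 2 ≤ (f ∩ e₀).card) (hab : Disjoint (ed p q a b) e₀) (hcd : Disjoint (ed p q c d) e₀)
    (hr : r ∉ e₀) (hrab : r ∉ ed p q a b) (hne : ed p q a b ≠ ed p q c d)
    (h₁ : 2 ≤ (f ∩ ed p q a b).card) (h₂ : 2 ≤ (f ∩ ed p q c d).card) :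
    r ∉ f ∧ (p ∈ f ∨ q ∈ f) := by
  set Z := f ∩ insert r (ed p q a b ∪ ed p q c d) with hZ
  have hZc : Z.card ≤ 2 := by
    have hd : Disjoint Z (f ∩ e₀) := by
      rw [Finset.disjoint_left] at hab hcd ⊢
      intro z hz hz'
      rw [Finset.mem_inter] at hz'
      rw [hZ, Finset.mem_inter, Finset.mem_insert, Finset.mem_union] at hz
      rcases hz.2 with rfl | h | h
      · exact hr hz'.2
      · exact hab h hz'.2
      · exact hcd h hz'.2
    have := Finset.card_le_card (Finset.union_subset (Finset.inter_subset_left : Z ⊆ f)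
      (Finset.inter_subset_left : f ∩ e₀ ⊆ f))
    rw [Finset.card_union_of_disjoint hd] at this
    omega
  have hZab : f ∩ ed p q a b = Z := by
    refine Finset.eq_of_subset_of_card_le (Finset.inter_subset_inter_left ?_) (by omega)
    exact Finset.subset_union_left.trans (Finset.subset_insert _ _)
  have hZcd : f ∩ ed p q c d = Z := by
    refine Finset.eq_of_subset_of_card_le (Finset.inter_subset_inter_left ?_) (by omega)
    exact Finset.subset_union_right.trans (Finset.subset_insert _ _)
  refine ⟨fun hrf => hrab ?_, ?_⟩
  · have : r ∈ Z := by simp [hZ, hrf]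
    rw [← hZab] at this
    exact (Finset.mem_inter.1 this).2
  -- Without `p` and `q`, the pair `Z` would be both `{a, b}` and `{c, d}`, and the blocks would
  -- coincide.
  · by_contra hpq
    rw [not_or] at hpq
    have key : ∀ x y : U, f ∩ ed p q x y = Z → Z = {x, y} := by
      intro x y hxy
      refine Finset.eq_of_subset_of_card_le (fun z hz => ?_) (Finset.card_le_two.trans ?_)
      · rw [← hxy, Finset.mem_inter] at hz
        have h2 := hz.2
        simp only [ed, Finset.mem_insert, Finset.mem_singleton] at h2 ⊢
        rcases h2 with rfl | rfl | h2
        · exact absurd hz.1 hpq.1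
        · exact absurd hz.1 hpq.2
        · exact h2
      · rw [← hZab]; exact h₁
    have : ({a, b} : Finset U) = {c, d} := (key a b hZab).symm.trans (key c d hZcd)
    exact hne (by rw [ed, ed, this])

/-- Edges near `e₀` and edges of the board of `p` and `q` hardly occur together in a book. -/
lemma card_bookEdges_inter_le_six {S T B : Finset U} {Q : Finset (Finset U)} {e : Finset U}
    (hb : IsBook S T B) (hO : O.card ≤ 5) (he₀ : e₀ ∈ O) (h4 : ∀ f ∈ O, f.card = 4)
    (hnear : ∀ f ∈ O, 2 ≤ (f ∩ e₀).card)
    (hbad : ((O.erase e₀).filter fun f => r ∉ f ∧ (p ∈ f ∨ q ∈ f)).card ≤ 2) (hr : r ∉ e₀)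
    (hQ : Q.card ≤ 3) (hQ' : ∀ g ∈ Q, Disjoint g e₀ ∧ r ∉ g ∧ ∃ x y, g = ed p q x y) :
    (bookEdges S T B ∩ insert e (Q ∪ O)).card ≤ 6 := by
  set C := bookEdges S T B
  have hsplit : (C ∩ insert e (Q ∪ O)).card ≤ (C ∩ Q).card + (C ∩ O).card + 1 := by
    have : C ∩ insert e (Q ∪ O) ⊆ insert e (C ∩ Q ∪ C ∩ O) := by
      intro x hx
      simp only [Finset.mem_inter, Finset.mem_insert, Finset.mem_union] at hx ⊢
      tauto
    have h1 := (Finset.card_le_card this).trans (Finset.card_insert_le _ _)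
    have h2 := Finset.card_union_le (C ∩ Q) (C ∩ O)
    omega
  have hCQ : (C ∩ Q).card ≤ 3 := (Finset.card_le_card Finset.inter_subset_right).trans hQ
  have hCO : (C ∩ O).card ≤ 5 := (Finset.card_le_card Finset.inter_subset_right).trans hO
  -- A book through `e₀` contains no edge of `Q`, all of these being disjoint from `e₀`. The count
  -- is 0 + 5 + 1.
  by_cases heC : e₀ ∈ C
  · have : C ∩ Q = ∅ := by
      rw [Finset.eq_empty_iff_forall_notMem]
      intro g hg
      rw [Finset.mem_inter] at hg
      have h2 := hb.two_le_card_inter hg.1 heC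
      rw [Finset.disjoint_iff_inter_eq_empty.1 (hQ' g hg.2).1] at h2
      simp at h2
    rw [this, Finset.card_empty] at hsplit
    omega
  · have hsub : C ∩ O ⊆ O.erase e₀ := by
      intro f hf
      rw [Finset.mem_inter] at hf
      exact Finset.mem_erase.2 ⟨fun h => heC (h ▸ hf.1), hf.2⟩
    have hcard4 : (C ∩ O).card ≤ 4 := by
      have := Finset.card_le_card hsub
      rw [Finset.card_erase_of_mem he₀] at this
      omega
    -- With two edges of `Q`, `near_of_two_blocks` leaves only two edges of `O`: 3 + 2 + 1. With at
    -- most one edge of `Q` the count is 1 + 4 + 1.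
    by_cases htwo : 1 < (C ∩ Q).card
    · obtain ⟨g, hg, g', hg', hne⟩ := Finset.one_lt_card.1 htwo
      rw [Finset.mem_inter] at hg hg'
      obtain ⟨hd, hrg, x, y, rfl⟩ := hQ' g hg.2
      obtain ⟨hd', hrg', x', y', rfl⟩ := hQ' g' hg'.2
      have : C ∩ O ⊆ (O.erase e₀).filter fun f => r ∉ f ∧ (p ∈ f ∨ q ∈ f) := by
        intro f hf
        refine Finset.mem_filter.2 ⟨hsub hf, ?_⟩
        rw [Finset.mem_inter] at hf
        exact near_of_two_blocks (h4 f hf.2) (hnear f hf.2) hd hd' hr hrg hne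
          (hb.two_le_card_inter hf.1 hg.1) (hb.two_le_card_inter hf.1 hg'.1)
      have := (Finset.card_le_card this).trans hbad
      omega
    · omega

variable [Fintype U]

/-- P1 has separated each of `v₁` and `v₂` from one leaf. -/
lemma reply_of_two_hits {v₁ v₂ a b w w' : U} (nd : [p, q, r, v₁, v₂, a, w, w'].Nodup)
    (hb : b = a ∨ b = w') (h : Position E₁ E₂ m) (hm : m + k + 40 ≤ Fintype.card U)
    (hO : O.card ≤ 5) (he₀ : e₀ ∈ O) (h4 : ∀ f ∈ O, f.card = 4)
    (hnear : ∀ f ∈ O, 2 ≤ (f ∩ e₀).card)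
    (hbad : ((O.erase e₀).filter fun f => r ∉ f ∧ (p ∈ f ∨ q ∈ f)).card ≤ 2)
    (hoff : ∀ x ∈ [p, q, r, v₁, v₂, a, w, w'], x ∉ e₀)
    (hE : E₁ ⊆ {ed p q v₁ a, ed p q v₂ b} ∪ O) (hfar : HasFarPair E₁)
    (hstar : ∀ x ∈ [v₁, v₂, a, w, w'], ed p q r x ∈ E₂) (h₀ : ed p q v₁ v₂ ∈ E₂) :
    Reply k E₁ E₂ := by
  simp at nd
  have hE7 : E₁.card ≤ 7 := by
    have h1 := (Finset.card_le_card hE).trans (Finset.card_union_le _ _)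
    have h2 := Finset.card_le_two (a := ed p q v₁ a) (b := ed p q v₂ b)
    omega
  have hz : ∀ x ∈ [v₁, v₂, a, w, w'], ∀ y ∈ [v₁, v₂, a, w, w'], ∀ z ∈ [p, q, x, y],
      z ∉ e₀ := by
    intro x hx y hy z hz
    refine hoff z ?_
    clear * - hx hy hz
    simp at *
    grind
  have hleaf : ∀ x ∈ [v₁, v₂, a, w, w'], ∀ y ∈ [v₁, v₂, a, w, w'], ed p q x y ∉ O := by
    exact fun x hx y hy => ed_notMem hnear (hz x hx y hy)
  have hbm : b ∈ [v₁, v₂, a, w, w'] := by rcases hb with rfl | rfl <;> simp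
  have hnot : ∀ x ∈ [v₁, v₂, a, w, w'], ∀ y ∈ [v₁, v₂, a, w, w'], ed p q x y ≠ ed p q v₁ a →
      ed p q x y ≠ ed p q v₂ b → ed p q x y ∉ E₁ := by
    intro x hx y hy h1 h2 hmem
    have := hE hmem
    simp only [Finset.mem_union, Finset.mem_insert, Finset.mem_singleton] at this
    rcases this with (h | h) | h
    · exact h1 h
    · exact h2 h
    · exact hleaf x hx y hy h
  have hbv : v₁ ≠ b ∧ v₂ ≠ b ∧ w ≠ b ∧ p ≠ b ∧ q ≠ b ∧ r ≠ b := by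
    rcases hb with rfl | rfl <;> tauto
  -- The leaf `w` differs from `a` and `b`. The move prepares the page of `w'` at the centre `v₁`,
  -- and also a page at the centre `w`.
  refine reply_of_claim h (by omega) (g := ed p q v₁ w) (card_ed (by clear * - nd; simp; grind))
    (hnot _ (by simp) _ (by simp) (ed_ne' (by clear * - nd hbv; grind)) (ed_ne (by clear * - nd hbv; grind))) fun E₂' hsub hpos => ?_
  have hsub₂ : E₂ ⊆ E₂' := (Finset.subset_insert _ _).trans hsub
  have h₁ : ed p q v₁ w ∈ E₂' := hsub (Finset.mem_insert_self _ _)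
  refine holds_of_reply hpos (Or.inl hE7) fun l hl e he hpos => ?_
  have hE8 : (insert e E₁).card ≤ 8 := (Finset.card_insert_le _ _).trans (by omega)
  have hharm : Harmless (insert e E₁) := (hfar.mono (Finset.subset_insert _ _)).harmless hE8
  -- If P1 blocks, P2 changes the centre to `w`: with `v₂` joined to it as well, `w` has two pages,
  -- and the third can be at `a` or at `w'`.
  by_cases he' : e = ed p q v₁ w'
  · refine reply_of_claim hpos (by omega) (g := ed p q v₂ w) (card_ed (by clear * - nd; simp; grind)) ?_
      fun E₂'' hsub' hpos' => ?_
    · rw [Finset.mem_insert, not_or, he']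
      exact ⟨ed_ne (by clear * - nd hbv; grind), hnot _ (by simp) _ (by simp) (ed_ne (by clear * - nd hbv; grind)) (ed_ne' (by clear * - nd hbv; grind))⟩
    refine holds_of_reply hpos' hharm fun j hj f hf hpos'' => ?_
    have hsub₂' : E₂' ⊆ E₂'' := (Finset.subset_insert _ _).trans hsub'
    have hE9 : insert f (insert e E₁) ⊆
        insert f ({ed p q v₁ a, ed p q v₂ b, ed p q v₁ w'} ∪ O) := by
      refine Finset.insert_subset_insert _ ?_
      intro x hx
      rw [Finset.mem_insert] at hx
      rcases hx with rfl | hx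
      · simp [he']
      · have := hE hx
        simp only [Finset.mem_union, Finset.mem_insert, Finset.mem_singleton] at this ⊢
        tauto
    have hoff' : ∀ x ∈ [v₁, v₂, a, w, w'], ∀ y ∈ [v₁, v₂, a, w, w'],
        Disjoint (ed p q x y) e₀ := fun x hx y hy => disjoint_ed (hz x hx y hy)
    -- P1 now has up to nine edges, one too many for the far pair to suffice. The three blocks `Q`
    -- and the near edges `O` have at most six edges in any book, even with `f`.
    have hharm' : Harmless (insert f (insert e E₁)) := by
      refine Or.inr (Or.inr ⟨(Finset.card_insert_le _ _).trans (by omega), fun S T B hB _ => ?_⟩)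
      refine (Finset.card_le_card (Finset.inter_subset_inter_left hE9)).trans
        (card_bookEdges_inter_le_six (p := p) (q := q) (r := r) hB hO he₀ h4 hnear hbad
          (hoff r (by simp)) Finset.card_le_three ?_)
      intro g hg
      simp only [Finset.mem_insert, Finset.mem_singleton] at hg
      rcases hg with rfl | rfl | rfl
      · exact ⟨hoff' _ (by simp) _ (by simp), by clear * - nd hbv; simp [ed]; grind, _, _, rfl⟩
      · exact ⟨hoff' _ (by simp) _ hbm, by clear * - nd hbv; simp [ed]; grind, _, _, rfl⟩
      · exact ⟨hoff' _ (by simp) _ (by simp), by clear * - nd hbv; simp [ed]; grind, _, _, rfl⟩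
    have hs : ∀ x ∈ [v₁, v₂, a, w, w'], ed p q r x ∈ E₂'' := fun x hx =>
      hsub₂' (hsub₂ (hstar x hx))
    have hwv₁ : ed p q w v₁ ∈ E₂'' := by rw [ed_comm]; exact hsub₂' h₁
    have hwv₂ : ed p q w v₂ ∈ E₂'' := by rw [ed_comm]; exact hsub' (Finset.mem_insert_self _ _)
    have hopen : ∀ x ∈ [a, w'], ed p q w x ∉ insert e E₁ := by
      intro x hx
      have hx' : x = a ∨ x = w' := by simpa using hx
      rw [Finset.mem_insert, not_or, he']
      refine ⟨ed_ne (by clear * - nd hbv; grind), hnot _ (by simp) _ ?_ (ed_ne (by clear * - nd hx'; grind))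
        (ed_ne (by clear * - nd hbv; grind))⟩
      rcases hx' with rfl | rfl <;> simp
    by_cases hf' : f = ed p q w a
    · refine reply_of_third_page (p := p) (q := q) (r := r) (c := w) (w₁ := v₁) (w₂ := v₂)
        (w₃ := w') (by clear * - nd; simp; grind) hpos'' (by omega) hharm' ?_ hwv₁ hwv₂ ?_
      · intro x hx
        refine hs x ?_
        clear * - hx
        simp at hx ⊢
        tauto
      · rw [Finset.mem_insert, not_or, hf']
        exact ⟨ed_ne' (by clear * - nd hbv; grind), hopen _ (by simp)⟩
    · refine reply_of_third_page (p := p) (q := q) (r := r) (c := w) (w₁ := v₁) (w₂ := v₂)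
        (w₃ := a) (by clear * - nd; simp; grind) hpos'' (by omega) hharm' ?_ hwv₁ hwv₂ ?_
      · intro x hx
        refine hs x ?_
        clear * - hx
        simp at hx ⊢
        tauto
      · rw [Finset.mem_insert, not_or]
        exact ⟨fun h => hf' h.symm, hopen _ (by simp)⟩
  · refine reply_of_third_page (p := p) (q := q) (r := r) (c := v₁) (w₁ := v₂) (w₂ := w)
      (w₃ := w') (by clear * - nd; simp; grind) hpos (by omega) hharm ?_ (hsub₂ h₀) h₁ ?_
    · intro x hx
      refine hsub₂ (hstar x ?_)
      clear * - hx
      simp at hx ⊢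
      tauto
    · rw [Finset.mem_insert, not_or]
      exact ⟨fun h => he' h.symm, hnot _ (by simp) _ (by simp) (ed_ne' (by clear * - nd hbv; grind))
        (ed_ne (by clear * - nd hbv; grind))⟩

end NearEdges

/-! ### The beginning of the opening: growing the star and choosing its centre -/

section Start

variable {U : Type*} [DecidableEq U] {E₁ E₂ O : Finset (Finset U)} {e₀ : Finset U} {m k : ℕ}
  {p q r : U}

lemma hasFarPair_of_disjoint {e : Finset U} (he₀ : e₀ ∈ E₁) (he : e ∈ E₁) (h : Disjoint e e₀) :
    HasFarPair E₁ :=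
  ⟨e, he, e₀, he₀, by rw [Finset.disjoint_iff_inter_eq_empty.1 h]; simp⟩

/-- Of three leaves, `a` and `b` occupy at most two; `w` is one different from both, and `w'` is the
remaining one. -/
lemma exists_perm_of_mem {x y z a b : U} (nd : [x, y, z].Nodup) (ha : a ∈ [x, y, z])
    (hb : b ∈ [x, y, z]) : ∃ w w', (∀ t, t ∈ [a, w, w'] ↔ t ∈ [x, y, z]) ∧ [a, w, w'].Nodup ∧
      (b = a ∨ b = w') := by
  simp at nd ha hb
  by_cases h1 : a = x
  · subst h1
    by_cases h2 : b = y
    · exact ⟨z, y, by simp; grind, by simp; grind, Or.inr h2⟩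
    · exact ⟨y, z, by simp, by simp; grind, by grind⟩
  · by_cases h3 : a = y
    · subst h3
      by_cases h2 : b = x
      · exact ⟨z, x, by simp; grind, by simp; grind, Or.inr h2⟩
      · exact ⟨x, z, by simp; grind, by simp; grind, by grind⟩
    · have : a = z := by tauto
      subst this
      by_cases h2 : b = x
      · exact ⟨y, x, by simp; grind, by simp; grind, Or.inr h2⟩
      · exact ⟨x, y, by simp; grind, by simp; grind, by grind⟩

/-- P2 has claimed `{p, q, r, x}` for all `x ∈ L`, away from the edge `e₀` of P1. -/
structure IsStar (E₁ E₂ : Finset (Finset U)) (e₀ : Finset U) (p q r : U) (L : Finset U) :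
    Prop where
  nodup : [p, q, r].Nodup
  first : e₀ ∈ E₁
  nonempty : L.Nonempty
  notMem : ∀ x ∈ L, x ≠ p ∧ x ≠ q ∧ x ≠ r
  off : ∀ x ∈ [p, q, r], x ∉ e₀
  leaf_off : ∀ x ∈ L, x ∉ e₀
  mem : ∀ x ∈ L, ed p q r x ∈ E₂

namespace IsStar

variable {L : Finset U}

/-- The edge `{p, q, r, x}` is symmetric in `p, q, r`, so any of the three can still become the
centre. -/
lemma rotate (h : IsStar E₁ E₂ e₀ p q r L) : IsStar E₁ E₂ e₀ q r p L where
  nodup := by have := h.nodup; simp at this ⊢; grind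
  first := h.first
  nonempty := h.nonempty
  notMem x hx := by have := h.notMem x hx; tauto
  off x hx := h.off x (by simp at hx ⊢; tauto)
  leaf_off := h.leaf_off
  mem x hx := by
    have : ed q r p x = ed p q r x := by ext; simp [ed]; tauto
    rw [this]; exact h.mem x hx

lemma insert_left (h : IsStar E₁ E₂ e₀ p q r L) (e : Finset U) :
    IsStar (insert e E₁) E₂ e₀ p q r L :=
  { h with first := Finset.mem_insert_of_mem h.first }

end IsStar

variable [Fintype U]

/-- P2 adds a new leaf to a star. -/
lemma reply_of_new_leaf (nd : [p, q, r].Nodup) (h : Position E₁ E₂ m)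
    (hm : m + 4 ≤ Fintype.card U) (hv : ∀ x ∈ [p, q, r], x ∈ verts E₁ E₂)
    (H : ∀ v, v ∉ verts E₁ E₂ → ∀ E₂', insert (ed p q r v) E₂ ⊆ E₂' → Position E₁ E₂' (m + 4) →
      Holds k E₁ E₂') : Reply k E₁ E₂ := by
  obtain ⟨v, hvn⟩ := exists_notMem_of_card_lt
    (show (verts E₁ E₂).card < Fintype.card U by have := h.card_verts; omega)
  have hne : ∀ x ∈ [p, q, r], x ≠ v := fun x hx hxv => hvn (hxv ▸ hv x hx)
  refine reply_of_claim h hm (g := ed p q r v) (card_ed ?_) (fun hE => hvn ?_) (H v hvn)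
  · simp at nd hne ⊢
    tauto
  · exact subset_verts_left hE (by simp [ed])

/-- P1 has answered the second edge which P2 needs in the star by separating two leaves. -/
lemma reply_of_early_hit {v₁ v₂ v₃ v₄ : U} {e : Finset U} (nd : [p, q, r, v₁, v₂, v₃, v₄].Nodup)
    (h : Position (insert e O) E₂ m) (hm : m + k + 56 ≤ Fintype.card U)
    (hO : O.card ≤ 5) (he₀ : e₀ ∈ O) (h4 : ∀ f ∈ O, f.card = 4)
    (hnear : ∀ f ∈ O, 2 ≤ (f ∩ e₀).card)
    (hbad : ((O.erase e₀).filter fun f => r ∉ f ∧ (p ∈ f ∨ q ∈ f)).card ≤ 2)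
    (hoff : ∀ x ∈ [p, q, r, v₁, v₂, v₃, v₄], x ∉ e₀)
    (he : ∃ x ∈ [v₁, v₂, v₃, v₄], ∃ y ∈ [v₁, v₂, v₃, v₄], e = ed p q x y)
    (hstar : ∀ x ∈ [v₁, v₂, v₃, v₄], ed p q r x ∈ E₂) (h₀ : ed p q v₁ v₂ ∈ E₂) :
    Reply k (insert e O) E₂ := by
  simp at nd
  have hfar : HasFarPair (insert e O) := by
    refine hasFarPair_of_disjoint (Finset.mem_insert_of_mem he₀) (Finset.mem_insert_self _ _) ?_
    obtain ⟨x, hx, y, hy, rfl⟩ := he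
    refine disjoint_ed fun z hz => hoff z ?_
    clear * - hx hy hz
    simp at *
    grind
  have hO6 : (insert e O).card ≤ 6 := (Finset.card_insert_le _ _).trans (by omega)
  have hsv : ∀ x ∈ [v₁, v₂, v₃, v₄], ed p q r x ⊆ verts (insert e O) E₂ := fun x hx =>
    subset_verts_right (hstar x hx)
  have hv₁ := hsv v₁ (by simp)
  refine reply_of_new_leaf (p := p) (q := q) (r := r) (by clear * - nd; simp; grind) h (by omega) ?_
    fun v₅ hv₅ E₂' hsub hpos => ?_
  · intro x hx
    refine hv₁ ?_
    simp at hx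
    simp [ed]
    tauto
  have hne : ∀ x ∈ [p, q, r, v₁, v₂, v₃, v₄], x ≠ v₅ := by
    rintro x hx rfl
    refine hv₅ ?_
    simp only [List.mem_cons, List.not_mem_nil, or_false] at hx
    rcases hx with rfl | rfl | rfl | hx
    · exact hv₁ (by simp [ed])
    · exact hv₁ (by simp [ed])
    · exact hv₁ (by simp [ed])
    · exact hsv x (by simpa using hx) (by simp [ed])
  have hv₅e : v₅ ∉ e₀ := fun hx => hv₅ (subset_verts_left (Finset.mem_insert_of_mem he₀) hx)
  simp only [List.mem_cons, List.not_mem_nil, or_false, forall_eq_or_imp, forall_eq] at hne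
  have hoff' : ∀ x ∈ [p, q, r, v₁, v₂, v₃, v₄, v₅], x ∉ e₀ := by
    simp only [List.mem_cons, List.not_mem_nil, or_false, forall_eq_or_imp, forall_eq] at hoff ⊢
    tauto
  have hsub₂ : E₂ ⊆ E₂' := (Finset.subset_insert _ _).trans hsub
  have hstar' : ∀ x ∈ [v₁, v₂, v₃, v₄, v₅], ed p q r x ∈ E₂' := by
    intro x hx
    by_cases hx5 : x = v₅
    · rw [hx5]; exact hsub (Finset.mem_insert_self _ _)
    · refine hsub₂ (hstar x ?_)
      clear * - hx hx5
      simp at hx ⊢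
      tauto
  refine holds_of_reply hpos (Or.inl (by omega)) fun l hl e' he' hpos' => ?_
  have hO7 : (insert e' (insert e O)).card ≤ 7 := (Finset.card_insert_le _ _).trans (by omega)
  have hfar' := hfar.mono (Finset.subset_insert e' _)
  have h₀' := hsub₂ h₀
  -- If `v₁` or `v₂` is not separated from any of the three other leaves, it is the centre.
  -- Otherwise `e` and `e'` are one block at each of `v₁` and `v₂`.
  by_cases h1 : ∃ x ∈ [v₃, v₄, v₅], ed p q v₁ x ∈ insert e' (insert e O)
  swap
  · push Not at h1
    refine reply_of_three_open (p := p) (q := q) (r := r) (c := v₁) (w₀ := v₂) (w₁ := v₃)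
      (w₂ := v₄) (w₃ := v₅) ?_ hpos' (by omega) hO7 hfar' hstar' h₀' h1
    clear * - nd hne; simp; grind
  by_cases h2 : ∃ x ∈ [v₃, v₄, v₅], ed p q v₂ x ∈ insert e' (insert e O)
  swap
  · push Not at h2
    refine reply_of_three_open (p := p) (q := q) (r := r) (c := v₂) (w₀ := v₁) (w₁ := v₃)
      (w₂ := v₄) (w₃ := v₅) ?_ hpos' (by omega) hO7 hfar' ?_ (by rwa [ed_comm]) h2
    · clear * - nd hne; simp; grind
    · intro x hx
      refine hstar' x ?_
      clear * - hx
      simp at hx ⊢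
      tauto
  obtain ⟨a, ha, ha'⟩ := h1
  obtain ⟨b, hb, hb'⟩ := h2
  have hleaf : ∀ x ∈ [v₁, v₂, v₃, v₄, v₅], ∀ y ∈ [v₁, v₂, v₃, v₄, v₅], ed p q x y ∉ O := by
    intro x hx y hy
    refine ed_notMem hnear fun z hz => hoff' z ?_
    clear * - hx hy hz
    simp at *
    grind
  obtain ⟨w, w', hw, hnd, hbw⟩ := exists_perm_of_mem (by clear * - nd hne; simp; grind) ha hb
  have hab : ed p q v₁ a ≠ ed p q v₂ b := by
    refine ed_ne ?_
    clear * - hb nd hne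
    simp at hb
    grind
  have hE : insert e' (insert e O) ⊆ {ed p q v₁ a, ed p q v₂ b} ∪ O := by
    have h3 := hleaf v₁ (by simp) a (List.mem_cons_of_mem _ (List.mem_cons_of_mem _ ha))
    have h4 := hleaf v₂ (by simp) b (List.mem_cons_of_mem _ (List.mem_cons_of_mem _ hb))
    simp only [Finset.mem_insert, h3, h4, or_false] at ha' hb'
    intro x hx
    simp only [Finset.mem_insert, Finset.mem_union, Finset.mem_singleton] at hx ⊢
    clear * - ha' hb' hab hx
    grind
  have hperm : ∀ t, t ∈ [a, w, w'] → t = v₃ ∨ t = v₄ ∨ t = v₅ := fun t ht => by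
    simpa using (hw t).1 ht
  have pa := hperm a (by simp)
  have pw := hperm w (by simp)
  have pw' := hperm w' (by simp)
  simp at hnd
  refine reply_of_two_hits (p := p) (q := q) (r := r) (v₁ := v₁) (v₂ := v₂) (a := a) (b := b)
    (w := w) (w' := w') ?_ hbw hpos' (by omega) hO he₀ h4 hnear hbad ?_ hE hfar' ?_ h₀'
  · simp only [List.nodup_cons, List.mem_cons, List.not_mem_nil, or_false, not_or,
      not_false_eq_true, List.nodup_nil, and_true]
    clear * - nd hne pa pw pw' hnd
    and_intros <;> grind
  · intro x hx
    refine hoff' x ?_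
    clear * - hx pa pw pw'
    simp at hx ⊢
    grind
  · intro x hx
    refine hstar' x ?_
    clear * - hx pa pw pw'
    simp at hx ⊢
    grind

/-- All edges of P1 are near to his first edge `e₀`. -/
lemma reply_of_near {v₁ v₂ v₃ v₄ : U} (nd : [p, q, r, v₁, v₂, v₃, v₄].Nodup)
    (h : Position O E₂ m) (hm : m + k + 64 ≤ Fintype.card U)
    (hO : O.card ≤ 5) (he₀ : e₀ ∈ O) (h4 : ∀ f ∈ O, f.card = 4)
    (hnear : ∀ f ∈ O, 2 ≤ (f ∩ e₀).card)
    (hbad : ((O.erase e₀).filter fun f => r ∉ f ∧ (p ∈ f ∨ q ∈ f)).card ≤ 2)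
    (hoff : ∀ x ∈ [p, q, r, v₁, v₂, v₃, v₄], x ∉ e₀)
    (hstar : ∀ x ∈ [v₁, v₂, v₃, v₄], ed p q r x ∈ E₂) : Reply k O E₂ := by
  have nd' := nd
  simp at nd
  have hoffed : ∀ x ∈ [v₁, v₂, v₃, v₄], ∀ y ∈ [v₁, v₂, v₃, v₄], ∀ z ∈ [p, q, x, y], z ∉ e₀ := by
    intro x hx y hy z hz
    refine hoff z ?_
    clear * - hx hy hz
    simp at *
    grind
  have hleaf : ∀ x ∈ [v₁, v₂, v₃, v₄], ∀ y ∈ [v₁, v₂, v₃, v₄], ed p q x y ∉ O :=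
    fun x hx y hy => ed_notMem hnear (hoffed x hx y hy)
  refine reply_of_claim h (by omega) (g := ed p q v₁ v₂) (card_ed (by clear * - nd; simp; grind))
    (hleaf _ (by simp) _ (by simp)) fun E₂' hsub hpos => ?_
  have hsub₂ : E₂ ⊆ E₂' := (Finset.subset_insert _ _).trans hsub
  have hstar' : ∀ x ∈ [v₁, v₂, v₃, v₄], ed p q r x ∈ E₂' := fun x hx => hsub₂ (hstar x hx)
  have h₁₂ : ed p q v₁ v₂ ∈ E₂' := hsub (Finset.mem_insert_self _ _)
  refine holds_of_reply hpos (Or.inl (by omega)) fun l hl e he hpos => ?_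
  -- An edge of P1 between two leaves is disjoint from `e₀` and gives a far pair, which buys P2 the
  -- time for a fifth leaf. Without it four leaves are enough.
  by_cases hhit : ∃ x ∈ [v₁, v₂, v₃, v₄], ∃ y ∈ [v₁, v₂, v₃, v₄], e = ed p q x y
  · exact reply_of_early_hit nd' hpos (by omega) hO he₀ h4 hnear hbad hoff hhit hstar' h₁₂
  push Not at hhit
  have hO6 : (insert e O).card ≤ 6 := (Finset.card_insert_le _ _).trans (by omega)
  have hleaf' : ∀ x ∈ [v₁, v₂, v₃, v₄], ∀ y ∈ [v₁, v₂, v₃, v₄], ed p q x y ∉ insert e O := by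
    intro x hx y hy
    rw [Finset.mem_insert, not_or]
    exact ⟨(hhit x hx y hy).symm, hleaf x hx y hy⟩
  refine reply_of_claim hpos (by omega) (g := ed p q v₁ v₃) (card_ed (by clear * - nd; simp; grind))
    (hleaf' _ (by simp) _ (by simp)) fun E₂'' hsub' hpos => ?_
  have hsub₂' : E₂' ⊆ E₂'' := (Finset.subset_insert _ _).trans hsub'
  have h₁₃ : ed p q v₁ v₃ ∈ E₂'' := hsub' (Finset.mem_insert_self _ _)
  refine holds_of_reply hpos (Or.inl (by omega)) fun l' hl' e' he' hpos => ?_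
  have hO7 : (insert e' (insert e O)).card ≤ 7 := (Finset.card_insert_le _ _).trans (by omega)
  by_cases hhit' : e' = ed p q v₁ v₄
  -- The triangle on `v₁, v₂, v₃` gives both `v₂` and `v₃` two pages, with `v₄` as the possible
  -- third for each. P1 cannot block both, and his block `e'` forms a far pair with `e₀`.
  · refine reply_of_claim hpos (by omega) (g := ed p q v₂ v₃) (card_ed (by clear * - nd; simp; grind)) ?_
      fun E₃ hsub'' hpos => ?_
    · rw [Finset.mem_insert, not_or, hhit']
      exact ⟨ed_ne (by clear * - nd; grind), hleaf' _ (by simp) _ (by simp)⟩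
    have hsub₂'' : E₂'' ⊆ E₃ := (Finset.subset_insert _ _).trans hsub''
    have h₂₃ : ed p q v₂ v₃ ∈ E₃ := hsub'' (Finset.mem_insert_self _ _)
    have hs : ∀ x ∈ [v₁, v₂, v₃, v₄], ed p q r x ∈ E₃ := fun x hx =>
      hsub₂'' (hsub₂' (hstar' x hx))
    refine holds_of_reply hpos (Or.inl hO7) fun l'' hl'' e'' he'' hpos => ?_
    have hharm : Harmless (insert e'' (insert e' (insert e O))) := by
      refine HasFarPair.harmless ?_ ((Finset.card_insert_le _ _).trans (by omega))
      refine hasFarPair_of_disjoint (e₀ := e₀) (e := e') (by simp [he₀]) (by simp) ?_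
      rw [hhit']
      exact disjoint_ed (hoffed _ (by simp) _ (by simp))
    have h₂₁ : ed p q v₂ v₁ ∈ E₃ := by rw [ed_comm]; exact hsub₂'' (hsub₂' h₁₂)
    have h₃₁ : ed p q v₃ v₁ ∈ E₃ := by rw [ed_comm]; exact hsub₂'' h₁₃
    have h₃₂ : ed p q v₃ v₂ ∈ E₃ := by rwa [ed_comm]
    by_cases hlast : e'' = ed p q v₂ v₄
    · refine reply_of_third_page (p := p) (q := q) (r := r) (c := v₃) (w₁ := v₁) (w₂ := v₂)
        (w₃ := v₄) (by clear * - nd; simp; grind) hpos (by omega) hharm ?_ h₃₁ h₃₂ ?_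
      · intro x hx
        refine hs x ?_
        clear * - hx
        simp at hx ⊢
        tauto
      · rw [Finset.mem_insert, Finset.mem_insert, not_or, not_or, hlast, hhit']
        exact ⟨ed_ne (by clear * - nd; grind), ed_ne (by clear * - nd; grind), hleaf' _ (by simp) _ (by simp)⟩
    · refine reply_of_third_page (p := p) (q := q) (r := r) (c := v₂) (w₁ := v₁) (w₂ := v₃)
        (w₃ := v₄) (by clear * - nd; simp; grind) hpos (by omega) hharm ?_ h₂₁ h₂₃ ?_
      · intro x hx
        refine hs x ?_
        clear * - hx
        simp at hx ⊢
        tauto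
      · rw [Finset.mem_insert, Finset.mem_insert, not_or, not_or, hhit']
        exact ⟨fun h => hlast h.symm, ed_ne (by clear * - nd; grind), hleaf' _ (by simp) _ (by simp)⟩
  · refine reply_of_third_page (p := p) (q := q) (r := r) (c := v₁) (w₁ := v₂) (w₂ := v₃)
      (w₃ := v₄) (by clear * - nd; simp; grind) hpos (by omega) (Or.inl hO7)
      (fun x hx => hsub₂' (hstar' x hx)) (hsub₂' h₁₂) h₁₃ ?_
    rw [Finset.mem_insert, not_or]
    exact ⟨fun h => hhit' h.symm, hleaf' _ (by simp) _ (by simp)⟩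

namespace IsStar

variable {L : Finset U}

/-- P2 adds a leaf. -/
lemma reply (h : IsStar E₁ E₂ e₀ p q r L) (hpos : Position E₁ E₂ m)
    (hm : m + 4 ≤ Fintype.card U)
    (H : ∀ E₂' L', IsStar E₁ E₂' e₀ p q r L' → L'.card = L.card + 1 →
      Position E₁ E₂' (m + 4) → Holds k E₁ E₂') : Reply k E₁ E₂ := by
  have hsv : ∀ x ∈ L, ed p q r x ⊆ verts E₁ E₂ := fun x hx => subset_verts_right (h.mem x hx)
  obtain ⟨y, hy⟩ := h.nonempty
  have hv : ∀ x ∈ [p, q, r], x ∈ verts E₁ E₂ := by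
    intro x hx
    refine hsv y hy ?_
    simp at hx
    simp [ed]
    tauto
  refine reply_of_new_leaf h.nodup hpos hm hv fun v hvn E₂' hsub hpos' => ?_
  have hvL : v ∉ L := fun hvL => hvn (hsv v hvL (by simp [ed]))
  refine H E₂' (insert v L) ⟨h.nodup, h.first, Finset.insert_nonempty _ _, ?_, h.off, ?_, ?_⟩
    (Finset.card_insert_of_notMem hvL) hpos'
  · intro x hx
    rcases Finset.mem_insert.1 hx with rfl | hx
    · have key : ∀ y ∈ [p, q, r], x ≠ y := fun y hy hxy => hvn (hxy ▸ hv y hy)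
      exact ⟨key p (by simp), key q (by simp), key r (by simp)⟩
    · exact h.notMem x hx
  · intro x hx
    rcases Finset.mem_insert.1 hx with rfl | hx
    · exact fun hxe => hvn (subset_verts_left h.first hxe)
    · exact h.leaf_off x hx
  · intro x hx
    rcases Finset.mem_insert.1 hx with rfl | hx
    · exact hsub (Finset.mem_insert_self _ _)
    · exact hsub ((Finset.subset_insert _ _) (h.mem x hx))

lemma reply_of_four_near (h : IsStar E₁ E₂ e₀ p q r L) (hL : L.card = 4)
    (hpos : Position E₁ E₂ m) (hm : m + k + 64 ≤ Fintype.card U) (hE : E₁.card ≤ 5)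
    (h4 : ∀ f ∈ E₁, f.card = 4) (hnear : ∀ f ∈ E₁, 2 ≤ (f ∩ e₀).card)
    (hbad : ((E₁.erase e₀).filter fun f => r ∉ f ∧ (p ∈ f ∨ q ∈ f)).card ≤ 2) :
    Reply k E₁ E₂ := by
  obtain ⟨v₁, hv₁⟩ := h.nonempty
  obtain ⟨v₂, v₃, v₄, h23, h24, h34, hv⟩ := Finset.card_eq_three.1
    (show (L.erase v₁).card = 3 by rw [Finset.card_erase_of_mem hv₁, hL])
  have hmem : ∀ x ∈ [v₂, v₃, v₄], x ≠ v₁ ∧ x ∈ L := by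
    intro x hx
    have : x ∈ L.erase v₁ := by rw [hv]; simpa using hx
    simpa using this
  have hmem' : ∀ x ∈ [v₁, v₂, v₃, v₄], x ∈ L := by
    intro x hx
    rcases List.mem_cons.1 hx with rfl | hx
    · exact hv₁
    · exact (hmem x hx).2
  have m2 := hmem v₂ (by simp)
  have m3 := hmem v₃ (by simp)
  have m4 := hmem v₄ (by simp)
  have n1 := h.notMem v₁ hv₁
  have n2 := h.notMem v₂ m2.2
  have n3 := h.notMem v₃ m3.2
  have n4 := h.notMem v₄ m4.2
  refine reply_of_near (p := p) (q := q) (r := r) (v₁ := v₁) (v₂ := v₂) (v₃ := v₃) (v₄ := v₄)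
    ?_ hpos hm hE h.first h4 hnear hbad ?_ fun x hx => h.mem x (hmem' x hx)
  · have := h.nodup
    simp at this
    simp only [List.nodup_cons, List.mem_cons, List.not_mem_nil, or_false, not_or,
      not_false_eq_true, List.nodup_nil, and_true]
    clear * - this m2 m3 m4 n1 n2 n3 n4 h23 h24 h34
    and_intros <;> grind
  · intro x hx
    by_cases hx' : x ∈ [p, q, r]
    · exact h.off x hx'
    · refine h.leaf_off x (hmem' x ?_)
      simp at hx hx' ⊢
      tauto

lemma reply_of_five_far (h : IsStar E₁ E₂ e₀ p q r L) (hL : L.card = 5)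
    (hpos : Position E₁ E₂ m) (hm : m + k + 32 ≤ Fintype.card U) (hE : E₁.card ≤ 6)
    (h4 : ∀ f ∈ E₁, f.card = 4) (hfar : HasFarPair E₁)
    (hone : ((E₁.erase e₀).filter fun f => p ∈ f ∧ q ∈ f ∧ r ∉ f).card ≤ 1) : Reply k E₁ E₂ := by
  refine reply_of_five_leaves h.nodup hL (fun hx => (h.notMem p hx).1 rfl)
    (fun hx => (h.notMem q hx).2.1 rfl) (fun hx => (h.notMem r hx).2.2 rfl) hpos hm hE hfar h4
    h.mem ((Finset.card_le_card fun f hf => ?_).trans hone)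
  rw [Finset.mem_filter] at hf ⊢
  refine ⟨Finset.mem_erase.2 ⟨?_, hf.1⟩, hf.2⟩
  rintro rfl
  exact h.off p (by simp) hf.2.1

/-- Without a far edge, the four edges of P1 other than `e₀` count at most twice each over the three
choices of centre; 8 < 9, so some choice has at most two bad edges. With a far edge P2 adds a leaf.
The five edges other than `e₀` then count at most once each; 5 < 6, so some choice has at most one
separating edge. -/
lemma reply_of_four (h : IsStar E₁ E₂ e₀ p q r L) (hL : L.card = 4)
    (hpos : Position E₁ E₂ m) (hm : m + k + 64 ≤ Fintype.card U) (hE : E₁.card ≤ 5)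
    (h4 : ∀ f ∈ E₁, f.card = 4) : Reply k E₁ E₂ := by
  by_cases hnear : ∀ f ∈ E₁, 2 ≤ (f ∩ e₀).card
  · have hF : (E₁.erase e₀).card ≤ 4 := by
      rw [Finset.card_erase_of_mem h.first]
      omega
    have hsum : ((E₁.erase e₀).filter fun f => r ∉ f ∧ (p ∈ f ∨ q ∈ f)).card +
        ((E₁.erase e₀).filter fun f => p ∉ f ∧ (q ∈ f ∨ r ∈ f)).card +
        ((E₁.erase e₀).filter fun f => q ∉ f ∧ (r ∈ f ∨ p ∈ f)).card ≤
        (E₁.erase e₀).card * 2 := by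
      simp only [Finset.card_filter, ← Finset.sum_add_distrib]
      refine Finset.sum_le_card_nsmul _ _ _ fun f _ => ?_
      by_cases hp : p ∈ f <;> by_cases hq : q ∈ f <;> by_cases hr : r ∈ f <;> simp [hp, hq, hr]
    rcases (by omega : ((E₁.erase e₀).filter fun f => r ∉ f ∧ (p ∈ f ∨ q ∈ f)).card ≤ 2 ∨
        ((E₁.erase e₀).filter fun f => p ∉ f ∧ (q ∈ f ∨ r ∈ f)).card ≤ 2 ∨
        ((E₁.erase e₀).filter fun f => q ∉ f ∧ (r ∈ f ∨ p ∈ f)).card ≤ 2) with hb | hb | hb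
    · exact h.reply_of_four_near hL hpos hm hE h4 hnear hb
    · exact h.rotate.reply_of_four_near hL hpos hm hE h4 hnear hb
    · exact h.rotate.rotate.reply_of_four_near hL hpos hm hE h4 hnear hb
  · push Not at hnear
    obtain ⟨f, hf, hfe⟩ := hnear
    have hfar : HasFarPair E₁ := ⟨f, hf, e₀, h.first, by omega⟩
    refine h.reply hpos (by omega) fun E₂' L' h' hL' hpos' => ?_
    refine holds_of_reply hpos' (Or.inl (by omega)) fun l hl e he hpos'' => ?_
    have h'' := h'.insert_left e
    have hE6 : (insert e E₁).card ≤ 6 := (Finset.card_insert_le _ _).trans (by omega)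
    have h4' : ∀ f ∈ insert e E₁, f.card = 4 := by
      intro f hf
      rcases Finset.mem_insert.1 hf with rfl | hf
      · exact he
      · exact h4 f hf
    have hfar' := hfar.mono (Finset.subset_insert e _)
    have hF : ((insert e E₁).erase e₀).card ≤ 5 := by
      rw [Finset.card_erase_of_mem h''.first]
      omega
    have hsum : (((insert e E₁).erase e₀).filter fun f => p ∈ f ∧ q ∈ f ∧ r ∉ f).card +
        (((insert e E₁).erase e₀).filter fun f => q ∈ f ∧ r ∈ f ∧ p ∉ f).card +
        (((insert e E₁).erase e₀).filter fun f => r ∈ f ∧ p ∈ f ∧ q ∉ f).card ≤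
        ((insert e E₁).erase e₀).card * 1 := by
      simp only [Finset.card_filter, ← Finset.sum_add_distrib]
      refine Finset.sum_le_card_nsmul _ _ _ fun f _ => ?_
      by_cases hp : p ∈ f <;> by_cases hq : q ∈ f <;> by_cases hr : r ∈ f <;> simp [hp, hq, hr]
    rcases (by omega : (((insert e E₁).erase e₀).filter fun f => p ∈ f ∧ q ∈ f ∧ r ∉ f).card ≤ 1 ∨
        (((insert e E₁).erase e₀).filter fun f => q ∈ f ∧ r ∈ f ∧ p ∉ f).card ≤ 1 ∨
        (((insert e E₁).erase e₀).filter fun f => r ∈ f ∧ p ∈ f ∧ q ∉ f).card ≤ 1) with hb | hb | hb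
    · exact h''.reply_of_five_far (by omega) hpos'' (by omega) hE6 h4' hfar' hb
    · exact h''.rotate.reply_of_five_far (by omega) hpos'' (by omega) hE6 h4' hfar' hb
    · exact h''.rotate.rotate.reply_of_five_far (by omega) hpos'' (by omega) hE6 h4' hfar' hb

/-- P2 extends his star until it has four leaves. -/
lemma reply_of_card_le (j : ℕ) : ∀ {E₁ E₂ : Finset (Finset U)} {L : Finset U} {m k : ℕ},
    IsStar E₁ E₂ e₀ p q r L → L.card + j = 4 → Position E₁ E₂ m →
    m + k + 64 + 8 * j ≤ Fintype.card U → E₁.card ≤ L.card + 1 → (∀ f ∈ E₁, f.card = 4) →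
    Reply k E₁ E₂ := by
  induction j with
  | zero =>
    intro E₁ E₂ L m k h hL hpos hm hE h4
    exact h.reply_of_four (by omega) hpos (by omega) (by omega) h4
  | succ j ih =>
    intro E₁ E₂ L m k h hL hpos hm hE h4
    refine h.reply hpos (by omega) fun E₂' L' h' hL' hpos' => ?_
    refine holds_of_reply hpos' (Or.inl (by omega)) fun l hl e he hpos'' => ?_
    refine ih (h'.insert_left e) (by omega) hpos'' (by omega)
      ((Finset.card_insert_le _ _).trans (by omega)) fun f hf => ?_
    rcases Finset.mem_insert.1 hf with rfl | hf
    · exact he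
    · exact h4 f hf

end IsStar

/-- From the empty board P2 holds out for all but a bounded number of `card U` rounds. -/
theorem holds_start (hk : k + 100 ≤ Fintype.card U) : Holds k (∅ : Finset (Finset U)) ∅ := by
  have hpos : Position (∅ : Finset (Finset U)) ∅ 0 := ⟨by simp, by simp [verts]⟩
  refine holds_of_reply hpos (Or.inl (by simp)) fun l hl e he hpos => ?_
  obtain ⟨g, hg, hd⟩ := exists_fresh e (by omega)
  obtain ⟨v, hv⟩ : g.Nonempty := Finset.card_pos.1 (by omega)
  obtain ⟨p, q, r, hpq, hpr, hqr, hpqr⟩ := Finset.card_eq_three.1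
    (show (g.erase v).card = 3 by rw [Finset.card_erase_of_mem hv, hg])
  have hmem : ∀ x ∈ [p, q, r], x ≠ v ∧ x ∈ g := by
    intro x hx
    have : x ∈ g.erase v := by rw [hpqr]; simpa using hx
    simpa using this
  have hoff : ∀ x ∈ g, x ∉ e := fun x hx hxe => Finset.disjoint_left.1 hd hx hxe
  have mp := hmem p (by simp)
  have mq := hmem q (by simp)
  have mr := hmem r (by simp)
  have hmemE : ∀ f ∈ insert e (∅ : Finset (Finset U)), f = e := by simp
  refine reply_of_claim hpos (by omega) (g := ed p q r v) (card_ed (by simp; tauto)) ?_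
    fun E₂' hsub hpos' => ?_
  · intro h
    exact hoff v hv (hmemE _ h ▸ by simp [ed])
  have hstar : IsStar (insert e (∅ : Finset (Finset U))) E₂' e p q r {v} := by
    refine ⟨by simp; tauto, by simp, by simp, ?_, fun x hx => hoff x (hmem x hx).2, ?_, ?_⟩
    · intro x hx
      rw [Finset.mem_singleton.1 hx]
      exact ⟨mp.1.symm, mq.1.symm, mr.1.symm⟩
    · intro x hx
      rw [Finset.mem_singleton.1 hx]
      exact hoff v hv
    · intro x hx
      rw [Finset.mem_singleton.1 hx]
      exact hsub (Finset.mem_insert_self _ _)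
  refine holds_of_reply hpos' (Or.inl (by simp)) fun l' hl' e' he' hpos'' => ?_
  -- After three moves at most 12 vertices are in use, and growing the star by three leaves asks for
  -- 64 + 8 * 3 more; hence the 100.
  refine (hstar.insert_left e').reply_of_card_le 3 (by simp) hpos'' (by omega)
    ((Finset.card_insert_le _ _).trans (by simp)) fun f hf => ?_
  rcases Finset.mem_insert.1 hf with rfl | hf
  · exact he'
  · rw [hmemE f hf]; exact he

end Start

/-! ### Translation between plays of the game and pairs of edge sets -/

section Game

variable {V : Type*}

lemma mem_iff_claimed {h : List (Set V)} {s : Set V} :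
    s ∈ h ↔ s ∈ claimedByP1 h ∨ s ∈ claimedByP2 h := by
  rw [List.mem_iff_getElem?]
  constructor
  · rintro ⟨k, hk⟩
    exact (Nat.even_or_odd k).imp (fun h => ⟨k, h, hk⟩) (fun h => ⟨k, h, hk⟩)
  · rintro (⟨k, -, hk⟩ | ⟨k, -, hk⟩) <;> exact ⟨k, hk⟩

lemma getElem?_append_singleton {h : List (Set V)} {e s : Set V} {k : ℕ} :
    (h ++ [e])[k]? = some s ↔ h[k]? = some s ∨ (k = h.length ∧ e = s) := by
  rcases lt_trichotomy k h.length with hk | rfl | hk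
  · simp [List.getElem?_append_left hk, hk.ne]
  · simp
  · have h1 : (h ++ [e])[k]? = none := List.getElem?_eq_none (by simp; omega)
    have h2 : h[k]? = none := List.getElem?_eq_none (by omega)
    simp [h1, h2, hk.ne']

/-- `E` consists of the edges in `s`. -/
def Represents (E : Finset (Finset V)) (s : Set (Set V)) : Prop :=
  ∀ t, t ∈ s ↔ ∃ e ∈ E, (e : Set V) = t

lemma Represents.mem_iff {E : Finset (Finset V)} {s : Set (Set V)} (h : Represents E s)
    {e : Finset V} : (e : Set V) ∈ s ↔ e ∈ E := by
  rw [h]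
  exact ⟨fun ⟨f, hf, hfe⟩ => Finset.coe_injective hfe ▸ hf, fun he => ⟨e, he, rfl⟩⟩

lemma claimedByP1_append_of_odd {h : List (Set V)} {s : Set V} (hl : Odd h.length) :
    claimedByP1 (h ++ [s]) = claimedByP1 h := by
  ext t
  simp only [claimedByP1, Set.mem_ofPred_eq, getElem?_append_singleton]
  constructor
  · rintro ⟨k, hk, h | ⟨rfl, h⟩⟩
    · exact ⟨k, hk, h⟩
    · exact absurd hk (Nat.not_even_iff_odd.2 hl)
  · rintro ⟨k, hk, h'⟩
    exact ⟨k, hk, Or.inl h'⟩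

lemma claimedByP2_append_of_even {h : List (Set V)} {s : Set V} (hl : Even h.length) :
    claimedByP2 (h ++ [s]) = claimedByP2 h := by
  ext t
  simp only [claimedByP2, Set.mem_ofPred_eq, getElem?_append_singleton]
  constructor
  · rintro ⟨k, hk, h | ⟨rfl, h⟩⟩
    · exact ⟨k, hk, h⟩
    · exact absurd hk (Nat.not_odd_iff_even.2 hl)
  · rintro ⟨k, hk, h'⟩
    exact ⟨k, hk, Or.inl h'⟩

variable [DecidableEq V] {E : Finset (Finset V)} {h : List (Set V)} {e : Finset V}

lemma represents_claimedByP1_append_of_even (hE : Represents E (claimedByP1 h))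
    (hl : Even h.length) : Represents (insert e E) (claimedByP1 (h ++ [(e : Set V)])) := by
  intro t
  simp only [claimedByP1, Set.mem_ofPred_eq, getElem?_append_singleton, Finset.mem_insert,
    exists_eq_or_imp]
  rw [← hE t]
  simp only [claimedByP1, Set.mem_ofPred_eq]
  constructor
  · rintro ⟨k, hk, h | ⟨-, h⟩⟩
    · exact Or.inr ⟨k, hk, h⟩
    · exact Or.inl h
  · rintro (h' | ⟨k, hk, h'⟩)
    · exact ⟨_, hl, Or.inr ⟨rfl, h'⟩⟩
    · exact ⟨k, hk, Or.inl h'⟩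

lemma represents_claimedByP2_append_of_odd (hE : Represents E (claimedByP2 h))
    (hl : Odd h.length) : Represents (insert e E) (claimedByP2 (h ++ [(e : Set V)])) := by
  intro t
  simp only [claimedByP2, Set.mem_ofPred_eq, getElem?_append_singleton, Finset.mem_insert,
    exists_eq_or_imp]
  rw [← hE t]
  simp only [claimedByP2, Set.mem_ofPred_eq]
  constructor
  · rintro ⟨k, hk, h | ⟨-, h⟩⟩
    · exact Or.inr ⟨k, hk, h⟩
    · exact Or.inl h
  · rintro (h' | ⟨k, hk, h'⟩)
    · exact ⟨_, hl, Or.inr ⟨rfl, h'⟩⟩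
    · exact ⟨k, hk, Or.inl h'⟩

lemma image_edge (φ : Fin 6 ⊕ Fin 2 → V) (u v : Fin 6) :
    φ '' (Sum.inl '' (s(u, v) : Set (Fin 6)) ∪ Set.range Sum.inr) =
      (ed (φ (Sum.inr 0)) (φ (Sum.inr 1)) (φ (Sum.inl u)) (φ (Sum.inl v)) : Finset V) := by
  ext t
  simp only [ed, Set.image_union, Set.mem_union, Set.mem_image, Set.mem_range, Finset.coe_insert,
    Finset.coe_singleton, Set.mem_insert_iff, Set.mem_singleton_iff, SetLike.mem_coe, Sym2.mem_iff]
  constructor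
  · rintro (⟨_, ⟨i, rfl | rfl, rfl⟩, rfl⟩ | ⟨_, ⟨i, rfl⟩, rfl⟩)
    · simp
    · simp
    · fin_cases i <;> simp
  · rintro (rfl | rfl | rfl | rfl)
    · exact Or.inr ⟨_, ⟨0, rfl⟩, rfl⟩
    · exact Or.inr ⟨_, ⟨1, rfl⟩, rfl⟩
    · exact Or.inl ⟨_, ⟨u, Or.inl rfl, rfl⟩, rfl⟩
    · exact Or.inl ⟨_, ⟨v, Or.inr rfl, rfl⟩, rfl⟩

lemma forall_mem_edgeSet_G' {P : Set (Fin 6 ⊕ Fin 2) → Prop} : (∀ e ∈ G'.edgeSet, P e) ↔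
    ∀ u v, G.Adj u v → P (Sum.inl '' (s(u, v) : Set (Fin 6)) ∪ Set.range Sum.inr) := by
  constructor
  · exact fun h u v huv => h _ ⟨s(u, v), huv, rfl⟩
  · rintro h _ ⟨e, he, rfl⟩
    induction e with
    | h u v => exact h u v he

/-- The two elements of `S ∩ T` are the images of the added vertices, the remaining elements of `S`
and `T` are the ends of the base, and the page vertices are the other four vertices of `G`. -/
lemma containsCopy_iff {n : ℕ} {S : Set (Set (Fin n))} {E : Finset (Finset (Fin n))}
    (hE : Represents E S) : ContainsCopy (completeUniform n 4) G' S ↔ HasBook E := by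
  have hcopy : ∀ φ : Fin 6 ⊕ Fin 2 → Fin n, (∀ e ∈ G'.edgeSet, φ '' e ∈ S) ↔ ∀ u v, G.Adj u v →
      ed (φ (Sum.inr 0)) (φ (Sum.inr 1)) (φ (Sum.inl u)) (φ (Sum.inl v)) ∈ E := by
    intro φ
    simp only [forall_mem_edgeSet_G' (P := fun e => φ '' e ∈ S), image_edge, hE.mem_iff]
  constructor
  · rintro ⟨φ, hinj, -, hφ⟩
    rw [hcopy] at hφ
    have hinj : Function.Injective φ := fun a b => hinj (Set.mem_univ a) (Set.mem_univ b)
    have hed : ∀ x y a b : Fin n, insert b ({x, y, a} : Finset (Fin n)) = ed x y a b := by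
      intro x y a b; ext; simp [ed]; tauto
    have hK : ({φ (Sum.inr 0), φ (Sum.inr 1), φ (Sum.inl 0)} ∪
        {φ (Sum.inr 0), φ (Sum.inr 1), φ (Sum.inl 1)} : Finset (Fin n)) =
        ed (φ (Sum.inr 0)) (φ (Sum.inr 1)) (φ (Sum.inl 0)) (φ (Sum.inl 1)) := by
      ext; simp [ed]
    refine ⟨{φ (Sum.inr 0), φ (Sum.inr 1), φ (Sum.inl 0)},
      {φ (Sum.inr 0), φ (Sum.inr 1), φ (Sum.inl 1)},
      ({2, 3, 4, 5} : Finset (Fin 6)).image fun i => φ (Sum.inl i), ⟨?_, ?_, ?_, ?_⟩, ?_, ?_⟩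
    · rw [Finset.card_eq_three]
      exact ⟨_, _, _, by simp [hinj.eq_iff], by simp [hinj.eq_iff], by simp [hinj.eq_iff], rfl⟩
    · rw [Finset.card_eq_three]
      exact ⟨_, _, _, by simp [hinj.eq_iff], by simp [hinj.eq_iff], by simp [hinj.eq_iff], rfl⟩
    · rw [hK]
      exact card_ed (by simp [hinj.eq_iff])
    · intro b hb
      rw [hK]
      obtain ⟨i, hi, rfl⟩ := Finset.mem_image.1 hb
      simp only [ed, Finset.mem_insert, Finset.mem_singleton, hinj.eq_iff, reduceCtorEq, false_or,
        Sum.inl.injEq]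
      rintro (rfl | rfl) <;> simp at hi
    · exact (Finset.card_image_of_injective _ (hinj.comp Sum.inl_injective)).trans rfl
    · intro e he
      rcases mem_bookEdges.1 he with rfl | ⟨b, hb, rfl⟩ | ⟨b, hb, rfl⟩
      · rw [hK]
        exact hφ 0 1 ⟨by decide, Or.inl (by decide)⟩
      · obtain ⟨i, hi, rfl⟩ := Finset.mem_image.1 hb
        rw [hed]
        refine hφ 0 i ⟨?_, Or.inl (by decide)⟩
        rintro rfl
        simp at hi
      · obtain ⟨i, hi, rfl⟩ := Finset.mem_image.1 hb
        rw [hed]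
        refine hφ 1 i ⟨?_, Or.inl (by decide)⟩
        rintro rfl
        simp at hi
  · rintro ⟨P, Q, B, hb, hB, hsub⟩
    obtain ⟨x, y, hxy, hPQ⟩ := Finset.card_eq_two.1 hb.card_inter
    have hone : ∀ P Q : Finset (Fin n), IsBook P Q B → P ∩ Q = {x, y} → ∃ a, a ∉ Q ∧
        P = {x, y, a} := by
      intro P Q hb hPQ
      have h1 : (P \ Q).card = 1 := by
        have := Finset.card_sdiff_add_card_inter P Q
        rw [hb.card_inter, hb.card_left] at this
        omega
      obtain ⟨a, ha⟩ := Finset.card_eq_one.1 h1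
      have haQ : a ∈ P \ Q := by rw [ha]; simp
      refine ⟨a, (Finset.mem_sdiff.1 haQ).2, ?_⟩
      rw [← Finset.sdiff_union_inter P Q, ha, hPQ]
      ext; simp; tauto
    obtain ⟨a₀, ha₀, hP⟩ := hone P Q hb hPQ
    obtain ⟨a₁, ha₁, hQ⟩ := hone Q P hb.symm (by rw [Finset.inter_comm]; exact hPQ)
    let b : Fin 4 → Fin n := fun i => ((B.equivFinOfCardEq hB).symm i).1
    have hbB : ∀ i, b i ∈ B := fun i => ((B.equivFinOfCardEq hB).symm i).2
    have hbinj : Function.Injective b :=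
      Subtype.val_injective.comp (B.equivFinOfCardEq hB).symm.injective
    have hbn : ∀ i, b i ≠ x ∧ b i ≠ y ∧ b i ≠ a₀ ∧ b i ≠ a₁ := by
      intro i
      have := hb.notMem _ (hbB i)
      rw [hP, hQ] at this
      simp at this
      tauto
    have hxya : a₁ ≠ x ∧ a₁ ≠ y ∧ a₁ ≠ a₀ ∧ a₀ ≠ x ∧ a₀ ≠ y := by
      rw [hP] at ha₁
      rw [hQ] at ha₀
      simp at ha₁ ha₀
      tauto
    let f : Fin 6 → Fin n := Fin.cons a₀ (Fin.cons a₁ b : Fin 5 → Fin n)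
    let φ : Fin 6 ⊕ Fin 2 → Fin n := Sum.elim f ![x, y]
    have hf : ∀ i, f i = a₀ ∨ f i = a₁ ∨ ∃ j, f i = b j := by
      intro i
      refine Fin.cases (Or.inl rfl) (fun i => ?_) i
      refine Fin.cases (Or.inr (Or.inl rfl)) (fun i => Or.inr (Or.inr ⟨i, rfl⟩)) i
    have hφ : Function.Injective φ := by
      refine Function.Injective.sumElim ?_ ?_ ?_
      · refine Fin.cons_injective_iff.2 ⟨?_, Fin.cons_injective_iff.2 ⟨?_, hbinj⟩⟩
        · rintro ⟨i, hi⟩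
          revert hi
          refine Fin.cases ?_ (fun i => ?_) i
          · exact hxya.2.2.1
          · exact (hbn i).2.2.1
        · rintro ⟨i, hi⟩
          exact (hbn i).2.2.2 hi
      · intro i j
        fin_cases i <;> fin_cases j <;> simp [hxy, hxy.symm]
      · intro i j
        rcases hf i with h | h | ⟨l, h⟩ <;> rw [h] <;> fin_cases j
        · exact hxya.2.2.2.1
        · exact hxya.2.2.2.2
        · exact hxya.1
        · exact hxya.2.1
        · exact (hbn l).1
        · exact (hbn l).2.1
    have hK : ed x y a₀ a₁ ∈ E := by
      have : P ∪ Q = ed x y a₀ a₁ := by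
        rw [hP, hQ]; ext; simp [ed]
      exact this ▸ hsub spine_mem_bookEdges
    have h₀ : ∀ j, ed x y a₀ (b j) ∈ E := by
      intro j
      have : insert (b j) P = ed x y a₀ (b j) := by
        rw [hP]; ext; simp [ed]; tauto
      exact this ▸ hsub (left_mem_bookEdges (hbB j))
    have h₁ : ∀ j, ed x y a₁ (b j) ∈ E := by
      intro j
      have : insert (b j) Q = ed x y a₁ (b j) := by
        rw [hQ]; ext; simp [ed]; tauto
      exact this ▸ hsub (right_mem_bookEdges (hbB j))
    have hmain : ∀ u v : Fin 6, u ≠ v → u < 2 → ed x y (f u) (f v) ∈ E := by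
      intro u v
      refine Fin.cases (fun hne _ => ?_) (fun u => Fin.cases (fun hne _ => ?_)
        (fun u _ hlt => ?_) u) u
      · revert hne
        refine Fin.cases (fun hne => absurd rfl hne) (fun v => Fin.cases (fun _ => hK)
          (fun v _ => h₀ v) v) v
      · revert hne
        refine Fin.cases (fun _ => ?_) (fun v => Fin.cases (fun hne => absurd rfl hne)
          (fun v _ => h₁ v) v) v
        rw [ed_comm]
        exact hK
      · exfalso
        have : (u.succ.succ : Fin 6).val < 2 := hlt
        simp at this
    refine ⟨φ, hφ.injOn, fun _ _ => Set.mem_univ _, (hcopy φ).2 fun u v huv => ?_⟩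
    rcases huv.2 with hlt | hlt
    · exact hmain u v huv.1 hlt
    · rw [ed_comm]
      exact hmain v u huv.1.symm hlt

/-- A position in which P2 can hold out for `k` rounds is reached by a play which can be continued
for `2 * k` moves. -/
lemma StrategyP1.GuaranteesWinInLessThan.length_add_lt {n N : ℕ}
    {σ : StrategyP1 (completeUniform n 4) G'} (hσ : σ.GuaranteesWinInLessThan N) (k : ℕ) :
    ∀ {h : List (Set (Fin n))} {E₁ E₂ : Finset (Finset (Fin n))},
    IsPlay (completeUniform n 4) G' h → σ.Follows h → Even h.length →
    Represents E₁ (claimedByP1 h) → Represents E₂ (claimedByP2 h) → ¬ HasBook E₁ →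
    Holds k E₁ E₂ → h.length + 2 * k < N := by
  induction k with
  | zero => exact fun hp hf _ _ _ _ _ => (hσ _ hp hf).1
  | succ k ih =>
    intro h E₁ E₂ hp hf hl h₁ h₂ hb hk
    -- A finished play would contain a book of P1, by the guarantee. So the game is still open, and
    -- in particular the board is not full.
    have hnf : ¬ Finished (completeUniform n 4) G' h := fun hfin =>
      hb ((containsCopy_iff h₁).1 ((hσ h hp hf).2 hfin))
    obtain ⟨hmem, hnew⟩ := σ.legal h hp hl hnf
    have hcard : (σ.next h).ncard = 4 := hmem
    obtain ⟨e, he⟩ : ∃ e : Finset (Fin n), (e : Set (Fin n)) = σ.next h :=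
      ⟨(Set.toFinite (σ.next h)).toFinset, by simp⟩
    rw [← he] at hnew hmem
    rw [← he, Set.ncard_coe_finset] at hcard
    rw [mem_iff_claimed, not_or, h₁.mem_iff, h₂.mem_iff] at hnew
    obtain ⟨hbe, f, hf4, hf₁, hf₂, hcont⟩ := holds_succ.1 hk e hcard hnew.1 hnew.2
    have hp' : IsPlay (completeUniform n 4) G' (h ++ [(e : Set (Fin n))]) :=
      hp.move (fun hd => hnf (Or.inl hd)) hmem
        (by rw [mem_iff_claimed, not_or, h₁.mem_iff, h₂.mem_iff]; exact hnew)
    have hfol' : σ.Follows (h ++ [(e : Set (Fin n))]) := by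
      intro j hj hje
      rcases Nat.lt_or_ge j h.length with hlt | hge
      · rw [List.getElem_append_left hlt, List.take_append_of_le_length hlt.le]
        exact hf j hlt hje
      · have hjl : j = h.length := by simp at hj; omega
        subst hjl
        simp [he]
    have hl' : Odd (h ++ [(e : Set (Fin n))]).length := by
      simpa using hl.add_one
    have h₁' := represents_claimedByP1_append_of_even (e := e) h₁ hl
    have h₂' : Represents E₂ (claimedByP2 (h ++ [(e : Set (Fin n))])) := by
      rwa [claimedByP2_append_of_even hl]
    have hnf' : ¬ Finished (completeUniform n 4) G' (h ++ [(e : Set (Fin n))]) := fun hfin =>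
      hbe ((containsCopy_iff h₁').1 ((hσ _ hp' hfol').2 hfin))
    have hp'' : IsPlay (completeUniform n 4) G' (h ++ [(e : Set (Fin n))] ++ [(f : Set (Fin n))]) :=
      hp'.move (fun hd => hnf' (Or.inl hd))
        (show (f : Set (Fin n)).ncard = 4 by rw [Set.ncard_coe_finset, hf4])
        (by rw [mem_iff_claimed, not_or, h₁'.mem_iff, h₂'.mem_iff]; exact ⟨hf₁, hf₂⟩)
    have hfol'' : σ.Follows (h ++ [(e : Set (Fin n))] ++ [(f : Set (Fin n))]) := by
      intro j hj hje
      rcases Nat.lt_or_ge j (h ++ [(e : Set (Fin n))]).length with hlt | hge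
      · rw [List.getElem_append_left hlt, List.take_append_of_le_length hlt.le]
        exact hfol' j hlt hje
      · have hjl : j = (h ++ [(e : Set (Fin n))]).length := by
          rw [List.length_append (bs := [(f : Set (Fin n))]), List.length_singleton] at hj
          omega
        exact absurd hje (hjl ▸ Nat.not_even_iff_odd.2 hl')
    have h₁'' : Represents (insert e E₁)
        (claimedByP1 (h ++ [(e : Set (Fin n))] ++ [(f : Set (Fin n))])) := by
      rwa [claimedByP1_append_of_odd hl']
    have h₂'' := represents_claimedByP2_append_of_odd (e := f) h₂' hl'
    rcases hcont with hwin | hcont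
    -- A book of P2 ends the play, and the guarantee would then require P1 to have one too.
    · exact absurd ((containsCopy_iff h₁'').1 ((hσ _ hp'' hfol'').2
        (Or.inl (Or.inr ((containsCopy_iff h₂'').2 hwin))))) hbe
    · have := ih hp'' hfol'' (by
        rw [List.length_append (bs := [(f : Set (Fin n))])]
        exact hl'.add_one) h₁'' h₂'' hbe hcont
      simp only [List.length_append, List.length_singleton] at this
      omega

end Game

end StrongRamsey

theorem mainTheorem4 :
    ∃ C : ℕ, ∀ n N : ℕ, (N : ℤ) ≤ 2 * (n : ℤ) - (C : ℤ) →
      ¬ ∃ σ : StrongRamsey.StrategyP1 (StrongRamsey.completeUniform n 4) StrongRamsey.G',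
        σ.GuaranteesWinInLessThan N := by
  -- P2 holds out for `n - 100` rounds of two moves, hence 200. For `n < 100` the subtraction
  -- truncates to 0, and `hN` is impossible because its right-hand side is negative.
  refine ⟨200, fun n N hN => ?_⟩
  rintro ⟨σ, hσ⟩
  have hholds : StrongRamsey.Holds (n - 100) (∅ : Finset (Finset (Fin n))) ∅ := by
    rcases Nat.lt_or_ge n 100 with hn | hn
    · rw [Nat.sub_eq_zero_of_le hn.le]
      exact StrongRamsey.holds_zero _ _
    · exact StrongRamsey.holds_start (by rw [Fintype.card_fin]; omega)
  have := hσ.length_add_lt (n - 100) (h := []) StrongRamsey.IsPlay.start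
    (fun k hk => absurd hk (by simp)) (by simp)
    (E₁ := ∅) (E₂ := ∅) (by simp [StrongRamsey.Represents, StrongRamsey.claimedByP1])
    (by simp [StrongRamsey.Represents, StrongRamsey.claimedByP2])
    (fun h => absurd h.nine_le_card (by simp)) hholds
  simp only [List.length_nil] at this
  omega
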